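/- For a real number $y$ let $\|y\|_{\mathbb R/\mathbb Z}$ denote the distance from $y$ to the nearest integer. For real $\alpha$ and $x$ define the resonance strength $$\delta(\alpha,x)=\limsup_{k\in\mathbb Z,\ |k|\to\infty}\ -\frac{\log\|x-k\alpha\|_{\mathbb R/\mathbb Z}}{|k|}\in[0,\infty],$$ with the convention $\delta(\alpha,x)=\infty$ if $x\equiv k\alpha \pmod{\mathbb Z}$ for some $k\in\mathbb Z$, and for $0<\delta\le\infty$ put $D(\delta)=\{x\in[0,1]:\delta(\alpha,x)=\delta\}$. For real $s$ let $\omega_s(0)=0$ and $\omega_s(r)=(-\log r)^{-s}$ for $0<r<1$. For $S\subset\mathbb R$ let $$\mathcal H^{\omega_s}(S)=\lim_{\varepsilon\to0^+}\ \inf\Big\{\sum_{i=1}^\infty\omega_s(b_i-a_i):\ S\subset\bigcup_{i=1}^\infty(a_i,b_i),\ 0\le b_i-a_i\le\varepsilon\Big\},$$ $$\dim_{H,\log}(S)=\inf\{s>0:\mathcal H^{\omega_s}(S)<\infty\}.$$ **Theorem.** Let $\alpha$ be any irrational real number and let $0<\delta\le\infty$. Then $$\mathcal H^{\omega_s}(D(\delta))=\begin{cases}0,&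 s>1,\\ \infty,& s\le1,\end{cases}$$ for every real $s$, and consequently $\dim_{H,\log}D(\delta)=1$. -/

import Mathlib

open Filter Topology Set
open scoped ENNReal

noncomputable section

namespace LogHausdorff

/-- The logarithmic gauge `ω_s(r) = (-log r)^(-s)` for `0 < r < 1`, with `ω_s(0) = 0`.
Arguments outside `[0, 1)` get the value `0`; they are never used in `gaugeMeasure`. -/
def logGauge (s r : ℝ) : ℝ :=
  if 0 < r ∧ r < 1 then (-Real.log r) ^ (-s) else 0

/-- The `ε`-premeasure: the infimum of `∑ ω(b_i - a_i)` over all countable covers of `S` by open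
intervals `(a_i, b_i)` of length at most `ε`. Degenerate (empty) intervals are allowed, so that
finite covers are included. -/
def gaugePremeasure (ω : ℝ → ℝ) (ε : ℝ) (S : Set ℝ) : ℝ≥0∞ :=
  sInf {t : ℝ≥0∞ | ∃ a b : ℕ → ℝ,
    (∀ i, a i ≤ b i ∧ b i - a i ≤ ε) ∧ S ⊆ ⋃ i, Ioo (a i) (b i) ∧
      t = ∑' i, ENNReal.ofReal (ω (b i - a i))}

/-- The `ω`-Hausdorff measure of `S ⊆ ℝ`, for a gauge `ω ≥ 0` on `[0, 1)`: the limit of the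
`ε`-premeasures as `ε → 0⁺`, which is their supremum over `0 < ε < 1`
(see `tendsto_gaugePremeasure`). -/
def gaugeMeasure (ω : ℝ → ℝ) (S : Set ℝ) : ℝ≥0∞ :=
  ⨆ ε ∈ Ioo (0 : ℝ) 1, gaugePremeasure ω ε S

theorem gaugePremeasure_antitone (ω : ℝ → ℝ) (S : Set ℝ) :
    Antitone fun ε => gaugePremeasure ω ε S := by
  intro ε ε' h
  refine sInf_le_sInf ?_
  rintro t ⟨a, b, hab, hS, ht⟩
  exact ⟨a, b, fun i => ⟨(hab i).1, (hab i).2.trans h⟩, hS, ht⟩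

theorem tendsto_gaugePremeasure (ω : ℝ → ℝ) (S : Set ℝ) :
    Tendsto (fun ε => gaugePremeasure ω ε S) (𝓝[>] 0) (𝓝 (gaugeMeasure ω S)) := by
  refine tendsto_order.2 ⟨fun c hc => ?_, fun c hc => ?_⟩
  · obtain ⟨ε, hε, hlt⟩ : ∃ ε ∈ Ioo (0 : ℝ) 1, c < gaugePremeasure ω ε S := by
      simpa only [gaugeMeasure, lt_iSup_iff, exists_prop] using hc
    filter_upwards [Ioo_mem_nhdsGT hε.1] with r hr
    exact hlt.trans_le (gaugePremeasure_antitone ω S hr.2.le)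
  · filter_upwards [Ioo_mem_nhdsGT (zero_lt_one (α := ℝ))] with r hr
    exact (le_iSup₂ (f := fun ε (_ : ε ∈ Ioo (0 : ℝ) 1) => gaugePremeasure ω ε S) r hr).trans_lt hc

/-- The logarithmic Hausdorff dimension `inf {s > 0 : H^{ω_s}(S) < ∞}`, in `[0, ∞]`. -/
def dimHLog (S : Set ℝ) : ℝ≥0∞ :=
  ⨅ (s : ℝ) (_ : 0 < s) (_ : gaugeMeasure (logGauge s) S < ⊤), ENNReal.ofReal s

/-- The resonance strength `limsup_{|k| → ∞} -log ‖φ - kα‖ / |k|`, an extended real number, where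
`k` runs over `ℤ` and `‖·‖` is the distance to the nearest integer (the norm of `ℝ/ℤ`), with the
value `∞` when `φ ≡ kα` mod `ℤ` for some integer `k`. The cofinite filter on `ℤ` is the filter
`|k| → ∞`. -/
def resonanceStrength (α φ : ℝ) : EReal :=
  open Classical in
  if ∃ k n : ℤ, φ = k * α + n then ⊤
  else limsup (fun k : ℤ =>
    ((-Real.log ‖((φ - k * α : ℝ) : UnitAddCircle)‖ / |(k : ℝ)| : ℝ) : EReal)) cofinite

/-- The level set `D(δ)` of points of `[0, 1]` with resonance strength `δ`. -/
def resonanceSet (α : ℝ) (δ : EReal) : Set ℝ :=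
  {x | x ∈ Icc (0 : ℝ) 1 ∧ resonanceStrength α x = δ}

end LogHausdorff

end

/-! For `s > 1` the natural cover suffices. A point of positive resonance strength lies within `exp
(-c |k|)` of infinitely many orbit points `k * α`, the gauge of such a length is about `(c |k|) ^
(-s)`, and this is summable over `k`; arbitrarily far tails still cover.

For `s ≤ 1` it is enough to treat `s = 1`. A cover with finite total gauge `T` and small total
length is shown to miss a point of `D(δ)`. The point is the limit of nested intervals `[c + r / 2, c
+ r]` with `c = k * α + n` and `r = exp (-(d * k))`. Each step approximates at a rate `d` while
keeping distance `exp (-(β |m|))` from the orbit points of the other indices `m` passed since the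
last step; with `d` and `β` both tending to `δ`, the limit has strength exactly `δ`
(`resonanceStrength_eq`).

The heart is `exists_refinement`: some candidate interval carries cover intervals of total gauge at
most half its own gauge. Candidates are taken at levels `q` that are Dirichlet denominators, with
`k` comparable to `q`. A level has about `l * q` candidates, each of gauge about `1 / (d * q)`, so
every level has total gauge about `l / d`, whatever `q`: this is the divergence of the harmonic
series that makes `s = 1` critical. If all candidates failed, `M` sparse levels would require a cost
proportional to `M * l / d`. But one covering interval of length `u` and gauge `w` pays at most `64
* M * u / d + 2 * w` over all of them (`sum_cost_le`). Since the lengths sum to a tiny fraction of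
`l`, the total is at most a much smaller multiple of `M * l / d` plus `2 * T`, impossible for large
`M`. Small gauge on the chosen interval gives small length there (`meetSum_length_le`), so the step
can be repeated. -/

namespace LogHausdorff

/-! ### Spacing and density of the orbit at Dirichlet denominators -/

/-- `q` is the denominator of a reduced fraction `p / q` with `|α - p / q| < 1 / q ^ 2`. -/
def IsDirichletDen (α : ℝ) (q : ℕ) : Prop :=
  0 < q ∧ ∃ p : ℤ, IsCoprime p (q : ℤ) ∧ |α - p / q| < 1 / (q : ℝ) ^ 2

/-- Rationals of bounded denominator keep a positive distance from an irrational `α`, so Dirichlet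
approximations with error below that distance have large denominators. -/
theorem exists_isDirichletDen_ge {α : ℝ} (hα : Irrational α) (N : ℕ) :
    ∃ q, N ≤ q ∧ IsDirichletDen α q := by
  obtain ⟨ε, hε, hN⟩ : ∃ ε > (0 : ℝ), ∀ r : ℚ, r.den ≤ N → ε ≤ dist α r := by
    have h := hα.eventually_forall_le_dist_cast_rat_of_den_le N
    obtain ⟨ε, h1, h2⟩ := ((h.filter_mono nhdsWithin_le_nhds).and
      (self_mem_nhdsWithin : Ioi (0 : ℝ) ∈ 𝓝[>] 0)).exists
    exact ⟨ε, h2, h1⟩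
  obtain ⟨n, hn⟩ := exists_nat_one_div_lt hε
  obtain ⟨r, hr, hrn⟩ := Real.exists_rat_abs_sub_le_and_den_le α (Nat.succ_pos n)
  have hden : (1 : ℝ) ≤ r.den := by exact_mod_cast r.pos
  refine ⟨r.den, ?_, r.pos, r.num, ?_, ?_⟩
  · by_contra hlt
    have h1 := hN r (by omega)
    rw [Real.dist_eq] at h1
    have h2 : (1 : ℝ) / (((n.succ : ℕ) + 1) * r.den) ≤ 1 / (n + 1) := by
      apply one_div_le_one_div_of_le (by positivity)
      push_cast
      nlinarith
    linarith
  · exact Int.isCoprime_iff_gcd_eq_one.2 r.reduced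
  · have h0 : ((r.num : ℝ) / (r.den : ℝ)) = r := by exact_mod_cast r.num_div_den
    rw [h0]
    refine hr.trans_lt ?_
    apply one_div_lt_one_div_of_lt (by positivity)
    have : (r.den : ℝ) ≤ n.succ := by exact_mod_cast hrn
    nlinarith

/-- Two points of the orbit whose indices differ by at most `q / 2` are `1 / (2q)`-separated. -/
theorem IsDirichletDen.le_abs_sub {α : ℝ} {q : ℕ} (hq : IsDirichletDen α q) {j : ℤ} (hj : j ≠ 0)
    (hjq : 2 * |j| ≤ q) (n : ℤ) : 1 / (2 * (q : ℝ)) ≤ |j * α - n| := by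
  obtain ⟨hq0, p, hp, hpq⟩ := hq
  have hqR : (0 : ℝ) < q := by exact_mod_cast hq0
  have hne : j * p - n * q ≠ 0 := by
    intro h
    have hdvd : (q : ℤ) ∣ j * p := ⟨n, by linarith⟩
    have hdvd' : (q : ℤ) ∣ j := hp.symm.dvd_of_dvd_mul_right hdvd
    have h1 := Int.le_of_dvd (abs_pos.2 hj) ((dvd_abs _ _).2 hdvd')
    have : (0 : ℤ) < q := by exact_mod_cast hq0
    omega
  have h1 : (1 : ℝ) ≤ |(j * p - n * q : ℝ)| := by exact_mod_cast Int.one_le_abs hne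
  -- The integer `j * p - n * q` is nonzero, and replacing `p / q` by `α` moves it by at most `1 /
  -- 2`.
  have h2 : (j * α - n) * q = (j * p - n * q) + j * q * (α - p / q) := by
    field_simp
    ring
  have h3 : |j * q * (α - p / q)| ≤ 1 / 2 := by
    rw [abs_mul, abs_mul, Nat.abs_cast]
    have h4 : 2 * |(j : ℝ)| ≤ q := by exact_mod_cast hjq
    calc |(j : ℝ)| * q * |α - p / q| ≤ (q / 2) * q * (1 / (q : ℝ) ^ 2) := by
          gcongr
          linarith
      _ = 1 / 2 := by field_simp
  have h5 : 1 / 2 ≤ |(j * α - n) * q| := by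
    rw [h2]
    have := abs_sub_abs_le_abs_add ((j * p - n * q : ℝ)) (j * q * (α - p / q))
    linarith
  rw [abs_mul, Nat.abs_cast] at h5
  rw [div_le_iff₀ (by positivity)]
  linarith

/-- Among `q` consecutive points of the orbit one lies in any given arc of length `3 / q`. -/
theorem IsDirichletDen.exists_mem_arc {α : ℝ} {q : ℕ} (hq : IsDirichletDen α q) (k₀ : ℤ) (t : ℝ) :
    ∃ i n : ℤ, 0 ≤ i ∧ i < q ∧ t ≤ (k₀ + i : ℤ) * α + n ∧ (k₀ + i : ℤ) * α + n < t + 3 / q := by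
  obtain ⟨hq0, p, ⟨u, v, huv⟩, hpq⟩ := hq
  have hqR : (0 : ℝ) < q := by exact_mod_cast hq0
  have hqZ : (0 : ℤ) < q := by exact_mod_cast hq0
  -- The fraction `j / q` is aimed at the middle third of the arc, leaving `1 / q` on both sides for
  -- the error `i * (α - p / q)`. The index is then `j` times the inverse `u` of `p` modulo `q`.
  set j : ℤ := ⌈q * (t + 1 / q - k₀ * α)⌉ with hj
  have hj1 : q * (t + 1 / q - k₀ * α) ≤ j := Int.le_ceil _
  have hj2 : (j : ℝ) < q * (t + 1 / q - k₀ * α) + 1 := Int.ceil_lt_add_one _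
  obtain ⟨e, he⟩ : (q : ℤ) ∣ (j * u) % q * p - j := by
    have h1 : j * u = (j * u) % q + q * (j * u / q) := (Int.emod_add_mul_ediv _ _).symm
    refine ⟨-(j * v) - (j * u / q) * p, ?_⟩
    linear_combination (-p) * h1 + j * huv
  have hi0 : 0 ≤ (j * u) % q := Int.emod_nonneg _ hqZ.ne'
  have hi1 : (j * u) % q < q := Int.emod_lt_of_pos _ hqZ
  generalize (j * u) % q = i at he hi0 hi1
  refine ⟨i, -e, hi0, hi1, ?_⟩
  have heR : (i : ℝ) * p - j = q * e := by exact_mod_cast he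
  have hi0R : (0 : ℝ) ≤ i := by exact_mod_cast hi0
  have hi1R : (i : ℝ) ≤ q := by exact_mod_cast hi1.le
  have hexp : ((k₀ + i : ℤ) : ℝ) * α + (-e : ℤ) = k₀ * α + j / q + i * (α - p / q) := by
    push_cast
    field_simp
    linear_combination heR
  have herr : |i * (α - p / q)| ≤ 1 / q := by
    rw [abs_mul, abs_of_nonneg hi0R]
    calc (i : ℝ) * |α - p / q| ≤ q * (1 / (q : ℝ) ^ 2) := by gcongr
      _ = 1 / q := by field_simp
  have h1 : t + 1 / q ≤ k₀ * α + j / q := by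
    have : (t + 1 / q - k₀ * α) ≤ j / q := by rw [le_div_iff₀ hqR]; linarith
    linarith
  have h2 : k₀ * α + j / q < t + 2 / q := by
    have : j / q < (t + 1 / q - k₀ * α) + 1 / q := by
      rw [div_lt_iff₀ hqR, add_mul, one_div_mul_cancel hqR.ne']; linarith
    have h3 : (2 : ℝ) / q = 1 / q + 1 / q := by ring
    linarith
  have h3 : (3 : ℝ) / q = 2 / q + 1 / q := by ring
  rw [hexp]
  constructor <;> linarith [abs_le.1 herr]

/-! ### Counting orbit points with index in a band -/

/-- The integers in `[q / 8, q / 4]`. -/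
noncomputable def band (q : ℕ) : Finset ℤ := (Finset.Icc 0 (q : ℤ)).filter fun k => (q : ℤ) ≤ 8 * k ∧ 4 * k ≤ q

theorem mem_band {q : ℕ} {k : ℤ} : k ∈ band q ↔ (q : ℤ) ≤ 8 * k ∧ 4 * k ≤ q := by
  simp only [band, Finset.mem_filter, Finset.mem_Icc]
  omega

theorem card_le_of_separated {ι : Type*} (s : Finset ι) (f : ι → ℝ) {d x y : ℝ} (hd : 0 < d)
    (hxy : x ≤ y) (hf : ∀ i ∈ s, f i ∈ Icc x y)
    (hsep : ∀ i ∈ s, ∀ j ∈ s, i ≠ j → d ≤ |f i - f j|) : (s.card : ℝ) ≤ (y - x) / d + 1 := by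
  have h0 : 0 ≤ (y - x) / d := div_nonneg (by linarith) hd.le
  have hcard : s.card ≤ (Finset.range (⌊(y - x) / d⌋₊ + 1)).card := by
    apply Finset.card_le_card_of_injOn fun i => ⌊(f i - x) / d⌋₊
    · intro i hi
      simp only [Finset.coe_range, mem_Iio, Nat.lt_succ_iff]
      apply Nat.floor_le_floor
      have := (hf i hi).2
      gcongr
    · intro i hi j hj hij
      by_contra hne
      have h1 := hsep i hi j hj hne
      have h2 : (⌊(f i - x) / d⌋₊ : ℝ) = ⌊(f j - x) / d⌋₊ := by exact_mod_cast hij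
      have hi0 : 0 ≤ (f i - x) / d := div_nonneg (by linarith [(hf i hi).1]) hd.le
      have hj0 : 0 ≤ (f j - x) / d := div_nonneg (by linarith [(hf j hj).1]) hd.le
      have h3 := Nat.floor_le hi0
      have h4 := Nat.lt_floor_add_one ((f i - x) / d)
      have h5 := Nat.floor_le hj0
      have h6 := Nat.lt_floor_add_one ((f j - x) / d)
      have h7 : |(f i - x) / d - (f j - x) / d| < 1 := by
        rw [abs_lt]; constructor <;> linarith
      rw [← sub_div, abs_div, abs_of_pos hd, div_lt_one hd] at h7
      simp only [sub_sub_sub_cancel_right] at h7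
      linarith
  rw [Finset.card_range] at hcard
  calc (s.card : ℝ) ≤ ((⌊(y - x) / d⌋₊ + 1 : ℕ) : ℝ) := by exact_mod_cast hcard
    _ ≤ (y - x) / d + 1 := by push_cast; linarith [Nat.floor_le h0]

open Classical in
/-- A lower bound for the number of visits of the orbit to an interval. -/
theorem exists_forall_card_band_ge {α : ℝ} (hα : Irrational α) (a : ℝ) {l : ℝ} (hl : 0 < l)
    (hl1 : l ≤ 1) :
    ∃ N : ℕ, ∀ q : ℕ, N ≤ q → l * q / 192 ≤
      (((band q).filter fun k : ℤ => ∃ n : ℤ, (k * α + n : ℝ) ∈ Icc a (a + l)).card : ℝ) := by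
  obtain ⟨q', hq'l, hq'⟩ := exists_isDirichletDen_ge hα ⌈6 / l⌉₊
  have hq'0 : 0 < q' := hq'.1
  have hq'R : (0 : ℝ) < q' := by exact_mod_cast hq'0
  have h6 : 6 ≤ l * q' := by
    have := (Nat.le_ceil (6 / l)).trans (Nat.cast_le.2 hq'l)
    rw [div_le_iff₀ hl] at this
    linarith
  refine ⟨32 * q' + 16, fun q hq => ?_⟩
  -- `S` disjoint arcs of length `3 / q'` fit in the interval, and `W` blocks of `q'` consecutive
  -- indices fit in the band, using at most `q / 16` indices past `q / 8`. Each pair of a block and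
  -- an arc supplies its own index.
  set S := ⌊l * q' / 3⌋₊ with hS
  set W := q / (16 * q') with hW
  have hSl : (S : ℝ) ≤ l * q' / 3 := Nat.floor_le (by positivity)
  have hS2 : l * q' / 6 ≤ S := by
    have := Nat.lt_floor_add_one (l * q' / 3)
    rw [← hS] at this
    linarith
  have hW1 : W * (16 * q') ≤ q := Nat.div_mul_le_self _ _
  have hW2 : (q : ℝ) / (32 * q') ≤ W := by
    have h1 : q < (16 * q') * (W + 1) := Nat.lt_mul_div_succ q (by omega)
    have h2 : (q : ℝ) < (16 * q') * (W + 1) := by exact_mod_cast h1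
    have h3 : (32 * q' : ℝ) ≤ q := by exact_mod_cast (by omega : 32 * q' ≤ q)
    rw [div_le_iff₀ (by positivity)]
    nlinarith
  have key := fun (w s : ℕ) =>
    hq'.exists_mem_arc ((q / 8 + 1 : ℕ) + w * q' : ℤ) (a + 3 * s / q')
  choose i n hi0 hi1 hlo hhi using key
  set f : ℕ × ℕ → ℤ := fun z => ((q / 8 + 1 : ℕ) + z.1 * q' : ℤ) + i z.1 z.2 with hf
  have hcard : (Finset.range W ×ˢ Finset.range S).card ≤
      ((band q).filter fun k : ℤ => ∃ n : ℤ, (k * α + n : ℝ) ∈ Icc a (a + l)).card := by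
    apply Finset.card_le_card_of_injOn f
    · rintro ⟨w, s⟩ hz
      simp only [Finset.coe_product, Finset.coe_range, mem_prod, mem_Iio] at hz
      simp only [Finset.coe_filter, Set.mem_ofPred_eq, mem_band]
      have hwq : ((w : ℤ) + 1) * q' ≤ W * q' := by
        have : (w : ℤ) + 1 ≤ W := by exact_mod_cast hz.1
        gcongr
      have hW1' : (W : ℤ) * q' * 16 ≤ q := by
        have : (W : ℤ) * (16 * q') ≤ q := by exact_mod_cast hW1
        linarith
      have h0 := hi0 w s
      have h1 := hi1 w s
      have hw0 : (0 : ℤ) ≤ w * q' := by positivity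
      have hfz : f (w, s) = ((q / 8 + 1 : ℕ) + w * q' : ℤ) + i w s := rfl
      rw [add_mul, one_mul] at hwq
      refine ⟨⟨?_, ?_⟩, n w s, ?_, ?_⟩
      · rw [hfz]; push_cast; omega
      · rw [hfz]; push_cast; omega
      · have := hlo w s
        have h2 : (0 : ℝ) ≤ 3 * s / q' := by positivity
        rw [hfz]
        linarith
      · have := hhi w s
        have h2 : a + 3 * (s : ℝ) / q' + 3 / q' ≤ a + l := by
          have h3 : (s : ℝ) + 1 ≤ S := by exact_mod_cast hz.2
          have h4 : 3 * (s : ℝ) / q' + 3 / q' ≤ l := by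
            rw [← add_div, div_le_iff₀ hq'R]
            linarith
          linarith
        rw [hfz]
        linarith
    · rintro ⟨w, s⟩ hz ⟨w', s'⟩ hz' heq
      simp only [Finset.coe_product, Finset.coe_range, mem_prod, mem_Iio] at hz hz'
      have heq' : ((q / 8 + 1 : ℕ) + w * q' : ℤ) + i w s = ((q / 8 + 1 : ℕ) + w' * q' : ℤ) + i w' s' :=
        heq
      have h0 := hi0 w s
      have h1 := hi1 w s
      have h0' := hi0 w' s'
      have h1' := hi1 w' s'
      have hq'Z : (0 : ℤ) < q' := by exact_mod_cast hq'0
      have hww : (w : ℤ) = w' := by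
        have h2 : (w : ℤ) < w' + 1 := by
          by_contra hc
          push Not at hc
          nlinarith
        have h3 : (w' : ℤ) < w + 1 := by
          by_contra hc
          push Not at hc
          nlinarith
        omega
      have hww' : w = w' := by exact_mod_cast hww
      subst hww'
      have hlo1 := hlo w s
      have hh1 := hhi w s
      have hl2 := hlo w s'
      have hh2 := hhi w s'
      have hii : i w s = i w s' := by omega
      rw [hii] at hlo1 hh1
      -- As `l ≤ 1`, all arcs lie within one period, so one index cannot reach two arcs through
      -- different integer translates.
      have hs : ∀ t : ℕ, t < S → 3 * (t : ℝ) / q' + 3 / q' ≤ 1 := by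
        intro t ht
        have h3 : (t : ℝ) + 1 ≤ S := by exact_mod_cast ht
        rw [← add_div, div_le_one hq'R]
        nlinarith
      have hs1 := hs s hz.2
      have hs2 := hs s' hz'.2
      have hp : ∀ t : ℕ, 0 ≤ 3 * (t : ℝ) / q' := fun t => by positivity
      have hp1 := hp s
      have hp2 := hp s'
      have hnn : n w s = n w s' := by
        have h2 : (n w s : ℝ) < n w s' + 1 := by linarith
        have h3 : (n w s' : ℝ) < n w s + 1 := by linarith
        have h2' : n w s < n w s' + 1 := by exact_mod_cast h2
        have h3' : n w s' < n w s + 1 := by exact_mod_cast h3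
        omega
      rw [hnn] at hlo1 hh1
      have h2 : 3 * (s : ℝ) / q' < 3 * s' / q' + 3 / q' := by linarith
      have h3 : 3 * (s' : ℝ) / q' < 3 * s / q' + 3 / q' := by linarith
      rw [← add_div, div_lt_div_iff_of_pos_right hq'R] at h2 h3
      have h2' : (s : ℝ) < s' + 1 := by linarith
      have h3' : (s' : ℝ) < s + 1 := by linarith
      have h2'' : s < s' + 1 := by exact_mod_cast h2'
      have h3'' : s' < s + 1 := by exact_mod_cast h3'
      have : s = s' := by omega
      rw [this]
  rw [Finset.card_product, Finset.card_range, Finset.card_range] at hcard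
  calc l * q / 192 = (q / (32 * q')) * (l * q' / 6) := by field_simp; ring
    _ ≤ W * S := by gcongr
    _ ≤ _ := by exact_mod_cast hcard

open Classical in
theorem IsDirichletDen.card_near_le {α : ℝ} {q : ℕ} (hq : IsDirichletDen α q) {m : ℤ}
    (hm : 4 * |m| ≤ q) {ρ : ℝ} (hρ : 0 ≤ ρ) :
    (((band q).filter fun k : ℤ =>
      k ≠ m ∧ ∃ n : ℤ, |((k - m : ℤ) : ℝ) * α - n| < ρ).card : ℝ) ≤ 8 * q * ρ := by
  have hqR : (0 : ℝ) < q := by exact_mod_cast hq.1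
  set s := (band q).filter fun k : ℤ => k ≠ m ∧ ∃ n : ℤ, |((k - m : ℤ) : ℝ) * α - n| < ρ with hs
  have hm' := abs_le.1 (by omega : |m| ≤ q / 4)
  rcases s.eq_empty_or_nonempty with h | ⟨k₀, hk₀⟩
  · rw [h]; simp; positivity
  have hmem : ∀ k ∈ s, ((q : ℤ) ≤ 8 * k ∧ 4 * k ≤ q) ∧
      k ≠ m ∧ ∃ n : ℤ, |((k - m : ℤ) : ℝ) * α - n| < ρ := by
    intro k hk
    rwa [hs, Finset.mem_filter, mem_band] at hk
  choose! n hn using fun k hk => (hmem k hk).2.2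
  -- If any index is counted at all, `ρ` is at least the spacing; this absorbs the `+ 1` of the
  -- separated count.
  have hρq : 1 / (2 * (q : ℝ)) ≤ ρ := by
    obtain ⟨h1, h2, -⟩ := hmem k₀ hk₀
    refine (hq.le_abs_sub (sub_ne_zero.2 h2) ?_ (n k₀)).trans (hn k₀ hk₀).le
    have : |k₀ - m| ≤ q / 2 := abs_le.2 ⟨by omega, by omega⟩
    omega
  have hcard := card_le_of_separated s (fun k => ((k - m : ℤ) : ℝ) * α - n k)
    (d := 1 / (2 * (q : ℝ))) (x := -ρ) (y := ρ) (by positivity) (by linarith)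
    (fun k hk => abs_le.1 (hn k hk).le) (fun k hk k' hk' hne => by
      obtain ⟨h1, -⟩ := hmem k hk
      obtain ⟨h1', -⟩ := hmem k' hk'
      have := hq.le_abs_sub (sub_ne_zero.2 hne) (by
        have : |k - k'| ≤ q / 2 := abs_le.2 ⟨by omega, by omega⟩
        omega) (n k - n k')
      refine this.trans_eq ?_
      push_cast
      congr 1
      ring)
  have h1 : (1 : ℝ) ≤ 2 * q * ρ := by
    rw [div_le_iff₀ (by positivity)] at hρq
    linarith
  have h2 : (ρ - -ρ) / (1 / (2 * (q : ℝ))) = 4 * q * ρ := by field_simp; ring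
  rw [h2] at hcard
  linarith

open Classical in
/-- Many points of the orbit with index in a band lie in a given interval and keep prescribed
distances from the points of smaller index. -/
theorem exists_forall_card_selected_ge {α : ℝ} (hα : Irrational α) (a : ℝ) {l : ℝ} (hl : 0 < l)
    (hl1 : l ≤ 1) (ρ : ℤ → ℝ) (hρ : ∀ m, 0 ≤ ρ m) (hρl : ∀ s : Finset ℤ, ∑ m ∈ s, ρ m ≤ l / 3200) :
    ∃ N : ℕ, ∀ q : ℕ, N ≤ q → IsDirichletDen α q → l * q / 400 ≤
      (((band q).filter fun k : ℤ => (∃ n : ℤ, (k * α + n : ℝ) ∈ Icc a (a + l)) ∧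
        ∀ m : ℤ, 4 * |m| ≤ q → k ≠ m → ∀ n : ℤ, ρ m ≤ |((k - m : ℤ) : ℝ) * α - n|).card : ℝ) := by
  obtain ⟨N, hN⟩ := exists_forall_card_band_ge hα a hl hl1
  refine ⟨N, fun q hNq hq => ?_⟩
  have hqR : (0 : ℝ) < q := by exact_mod_cast hq.1
  have h1 := hN q hNq
  set A := (band q).filter fun k : ℤ => ∃ n : ℤ, (k * α + n : ℝ) ∈ Icc a (a + l) with hA
  set B := (band q).filter fun k : ℤ => (∃ n : ℤ, (k * α + n : ℝ) ∈ Icc a (a + l)) ∧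
        ∀ m : ℤ, 4 * |m| ≤ q → k ≠ m → ∀ n : ℤ, ρ m ≤ |((k - m : ℤ) : ℝ) * α - n| with hB
  set P := (Finset.Icc (-(q : ℤ)) q).filter fun m : ℤ => 4 * |m| ≤ q with hP
  set C : ℤ → Finset ℤ := fun m => (band q).filter fun k : ℤ =>
      k ≠ m ∧ ∃ n : ℤ, |((k - m : ℤ) : ℝ) * α - n| < ρ m with hC
  have hsub : A ⊆ B ∪ P.biUnion C := by
    intro k hk
    rw [hA, Finset.mem_filter] at hk
    rw [Finset.mem_union, or_iff_not_imp_left]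
    intro hkB
    rw [hB, Finset.mem_filter] at hkB
    push Not at hkB
    obtain ⟨m, hm, hkm, n, hn⟩ := hkB hk.1 hk.2
    rw [Finset.mem_biUnion]
    refine ⟨m, ?_, ?_⟩
    · rw [hP, Finset.mem_filter, Finset.mem_Icc]
      have := abs_le.1 (by omega : |m| ≤ q / 4)
      omega
    · rw [hC, Finset.mem_filter]
      exact ⟨hk.1, hkm, n, hn⟩
  have hcard : (A.card : ℝ) ≤ B.card + ∑ m ∈ P, ((C m).card : ℝ) := by
    have := (Finset.card_le_card hsub).trans ((Finset.card_union_le _ _).trans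
      (Nat.add_le_add_left Finset.card_biUnion_le _))
    exact_mod_cast this
  have hsum : ∑ m ∈ P, ((C m).card : ℝ) ≤ 8 * q * (l / 3200) := by
    calc ∑ m ∈ P, ((C m).card : ℝ) ≤ ∑ m ∈ P, 8 * q * ρ m := by
          apply Finset.sum_le_sum
          intro m hm
          rw [hP, Finset.mem_filter] at hm
          exact hq.card_near_le hm.2 (hρ m)
      _ = 8 * q * ∑ m ∈ P, ρ m := by rw [Finset.mul_sum]
      _ ≤ _ := by gcongr; exact hρl P
  -- The excluded indices number at most `l * q / 400`, and `1 / 192 ≥ 2 / 400`.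
  have : 0 < l * q := by positivity
  linarith

/-! ### Exponential tails, and the cost of one covering interval over sparse levels -/

/-- Telescoping: `1 + β ≤ exp β` bounds `β` times each term by a difference of consecutive
exponentials. -/
theorem sum_range_exp_neg_le {β : ℝ} (hβ : 0 < β) (K : ℝ) (N : ℕ) :
    ∑ n ∈ Finset.range N, Real.exp (-(β * (K + 1 + n))) ≤ Real.exp (-(β * K)) / β := by
  have key : ∀ N : ℕ, β * ∑ n ∈ Finset.range N, Real.exp (-(β * (K + 1 + n))) ≤
      Real.exp (-(β * K)) - Real.exp (-(β * (K + N))) := by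
    intro N
    induction N with
    | zero => simp
    | succ N ih =>
      rw [Finset.sum_range_succ, mul_add]
      have h1 : Real.exp (-(β * (K + N))) = Real.exp (-(β * (K + 1 + N))) * Real.exp β := by
        rw [← Real.exp_add]; congr 1; ring
      have h2 : Real.exp (-(β * (K + (N + 1 : ℕ)))) = Real.exp (-(β * (K + 1 + N))) := by
        congr 1; push_cast; ring
      have h3 := Real.add_one_le_exp β
      have h4 := Real.exp_pos (-(β * (K + 1 + N)))
      rw [h2]
      nlinarith
  rw [le_div_iff₀ hβ]
  linarith [key N, Real.exp_pos (-(β * (K + N)))]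

theorem sum_exp_neg_abs_le {β : ℝ} (hβ : 0 < β) {K : ℤ} (hK : 0 ≤ K) (s : Finset ℤ) :
    ∑ m ∈ s, (if K < |m| then Real.exp (-(β * |(m : ℝ)|)) else 0) ≤
      2 * (Real.exp (-(β * K)) / β) := by
  obtain ⟨N, hN⟩ : ∃ N : ℕ, ∀ m ∈ s, |m| < N := by
    refine ⟨s.sup (fun m => m.natAbs) + 1, fun m hm => ?_⟩
    have : m.natAbs ≤ s.sup (fun m => m.natAbs) := Finset.le_sup (f := fun m : ℤ => m.natAbs) hm
    rw [Int.abs_eq_natAbs]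
    omega
  set f : ℕ → ℤ := fun n => K + 1 + n with hf
  set g : ℕ → ℤ := fun n => -(K + 1 + n) with hg
  have hfi : Function.Injective f := fun a b h => by simp only [hf] at h; omega
  have hgi : Function.Injective g := fun a b h => by simp only [hg] at h; omega
  have hsub : s.filter (fun m => K < |m|) ⊆
      (Finset.range N).image f ∪ (Finset.range N).image g := by
    intro m hm
    rw [Finset.mem_filter] at hm
    have := hN m hm.1
    rw [Finset.mem_union, Finset.mem_image, Finset.mem_image]
    rcases abs_cases m with ⟨h, -⟩ | ⟨h, -⟩
    · exact Or.inl ⟨(m - (K + 1)).toNat, by rw [Finset.mem_range]; omega, by simp only [hf]; omega⟩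
    · exact Or.inr ⟨(-m - (K + 1)).toNat, by rw [Finset.mem_range]; omega, by simp only [hg]; omega⟩
  have hpos : ∀ m : ℤ, 0 ≤ Real.exp (-(β * |(m : ℝ)|)) := fun m => (Real.exp_pos _).le
  rw [← Finset.sum_filter]
  have hKR : (0 : ℝ) ≤ K := by exact_mod_cast hK
  calc _ ≤ ∑ m ∈ (Finset.range N).image f ∪ (Finset.range N).image g,
          Real.exp (-(β * |(m : ℝ)|)) :=
        Finset.sum_le_sum_of_subset_of_nonneg hsub fun m _ _ => hpos m
    _ ≤ ∑ m ∈ (Finset.range N).image f, Real.exp (-(β * |(m : ℝ)|)) +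
        ∑ m ∈ (Finset.range N).image g, Real.exp (-(β * |(m : ℝ)|)) := by
      rw [← Finset.sum_union_inter]
      exact le_add_of_nonneg_right (Finset.sum_nonneg fun m _ => hpos m)
    _ = 2 * ∑ n ∈ Finset.range N, Real.exp (-(β * ((K : ℝ) + 1 + n))) := by
      rw [Finset.sum_image hfi.injOn, Finset.sum_image hgi.injOn, two_mul]
      congr 1 <;> refine Finset.sum_congr rfl fun n _ => ?_
      · simp only [hf]
        push_cast
        rw [abs_of_nonneg (by positivity)]
      · simp only [hg]
        push_cast
        rw [abs_neg, abs_of_nonneg (by positivity)]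
    _ ≤ _ := by
      have := sum_range_exp_neg_le hβ K N
      linarith

open Classical in
/-- An interval of length `u` meets at most one, or else at most `8qu`, of the intervals
`[c_k + r_k / 2, c_k + r_k]`, when the `c_k` are `1 / (2q)`-separated. -/
theorem card_meets_le {G : Finset ℤ} {q : ℕ} (hq : 0 < q) {c r : ℤ → ℝ} {x y : ℝ} (hxy : x < y)
    (hr : ∀ k ∈ G, 0 < r k ∧ r k ≤ 1 / (8 * q))
    (hsep : ∀ k ∈ G, ∀ k' ∈ G, k ≠ k' → 1 / (2 * (q : ℝ)) ≤ |c k - c k'|) :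
    ((G.filter fun k => (Ioo x y ∩ Icc (c k + r k / 2) (c k + r k)).Nonempty).card : ℝ) ≤
      2 * q * (y - x) + 5 / 4 := by
  have hqR : (0 : ℝ) < q := by exact_mod_cast hq
  have h8 : 0 < 1 / (8 * (q : ℝ)) := by positivity
  have := card_le_of_separated
    (G.filter fun k => (Ioo x y ∩ Icc (c k + r k / 2) (c k + r k)).Nonempty) c
    (d := 1 / (2 * (q : ℝ))) (x := x - 1 / (8 * q)) (y := y) (by positivity) (by linarith)
    (fun k hk => by
      rw [Finset.mem_filter] at hk
      obtain ⟨hkG, z, hz1, hz2⟩ := hk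
      have := hr k hkG
      constructor <;> linarith [hz1.1, hz1.2, hz2.1, hz2.2])
    (fun k hk k' hk' => hsep k (Finset.mem_filter.1 hk).1 k' (Finset.mem_filter.1 hk').1)
  refine this.trans_eq ?_
  field_simp
  ring

open Classical in
/-- The cost of one covering interval `(x, y)` summed over `M` sparse levels of disjoint intervals:
all levels but the first that meets `(x, y)` contribute in proportion to `y - x`, up to a
geometric series. -/
theorem sum_cost_le {M : ℕ} {q : ℕ → ℕ} (hq0 : ∀ l, 0 < q l)
    (hq : ∀ l t, 16 ^ t * q l ≤ q (l + t)) {G : ℕ → Finset ℤ} {c : ℤ → ℝ} {d : ℝ} (hd : 0 < d)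
    (hG : ∀ l, ∀ k ∈ G l, (q l : ℤ) ≤ 8 * k ∧ 4 * k ≤ q l)
    (hr : ∀ l, ∀ k ∈ G l, Real.exp (-(d * k)) ≤ 1 / (8 * q l))
    (hsep : ∀ l, ∀ k ∈ G l, ∀ k' ∈ G l, k ≠ k' → 1 / (2 * (q l : ℝ)) ≤ |c k - c k'|)
    (hsep' : ∀ l l', l < l' → ∀ k ∈ G l, ∀ k' ∈ G l', 4 * Real.exp (-(d * k)) ≤ |c k - c k'|)
    {x y : ℝ} (hxy : x < y) (hxy1 : y - x < 1) :
    ∑ l ∈ Finset.range M, ∑ k ∈ (G l).filter (fun k => (Ioo x y ∩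
        Icc (c k + Real.exp (-(d * k)) / 2) (c k + Real.exp (-(d * k)))).Nonempty),
      min (logGauge 1 (y - x)) (1 / (d * k + Real.log 2)) ≤
      64 * M * (y - x) / d + 2 * logGauge 1 (y - x) := by
  set u := y - x with hu
  have hu0 : 0 < u := by linarith
  have hω : logGauge 1 u = (-Real.log u)⁻¹ := by
    rw [logGauge, if_pos ⟨hu0, hxy1⟩, Real.rpow_neg_one]
  have hlog : 0 < -Real.log u := by linarith [Real.log_neg hu0 hxy1]
  set w := logGauge 1 u with hw
  have hw0 : 0 < w := by rw [hω]; positivity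
  set H : ℕ → Finset ℤ := fun l => (G l).filter (fun k => (Ioo x y ∩
        Icc (c k + Real.exp (-(d * k)) / 2) (c k + Real.exp (-(d * k)))).Nonempty) with hH
  have hqR : ∀ l, (0 : ℝ) < q l := fun l => by exact_mod_cast hq0 l
  have hlog2 : 0 < Real.log 2 := Real.log_pos (by norm_num)
  have hcard : ∀ l, ((H l).card : ℝ) ≤ 2 * q l * u + 5 / 4 := fun l =>
    card_meets_le (hq0 l) (c := c) (r := fun k => Real.exp (-(d * k))) hxy
      (fun k hk => ⟨Real.exp_pos _, hr l k hk⟩) (hsep l)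
  have hHG : ∀ l, ∀ k ∈ H l, k ∈ G l := fun l k hk => (Finset.mem_filter.1 hk).1
  -- The summand `log 2` appears because the interval `[c k + r / 2, c k + r]` has length `r / 2`
  -- with `r = exp (-(d * k))`.
  have hωk : ∀ l, ∀ k ∈ G l, 1 / (d * k + Real.log 2) ≤ 8 / (d * q l) := by
    intro l k hk
    have h1 : (q l : ℝ) ≤ 8 * k := by exact_mod_cast (hG l k hk).1
    have h0 := hqR l
    rw [div_le_div_iff₀ (by nlinarith) (by positivity)]
    nlinarith
  have hcost : ∀ l, ∑ k ∈ H l, min w (1 / (d * k + Real.log 2)) ≤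
      (H l).card * (8 / (d * q l)) := by
    intro l
    rw [← nsmul_eq_mul]
    exact Finset.sum_le_card_nsmul _ _ _ fun k hk =>
      (min_le_right _ _).trans (hωk l k (hHG l k hk))
  have hcost' : ∀ l, ∑ k ∈ H l, min w (1 / (d * k + Real.log 2)) ≤
      16 * u / d + 10 / (d * q l) := by
    intro l
    refine (hcost l).trans ?_
    have h0 := hqR l
    calc ((H l).card : ℝ) * (8 / (d * q l)) ≤ (2 * q l * u + 5 / 4) * (8 / (d * q l)) := by
          gcongr; exact hcard l
      _ = 16 * u / d + 10 / (d * q l) := by field_simp; ring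
  have hud : 0 < u / d := by positivity
  have hud' : ∀ C : ℝ, C * u / d = C * (u / d) := fun C => by ring
  by_cases hne : ∃ l, (H l).Nonempty
  swap
  · push Not at hne
    have : ∀ l ∈ Finset.range M, ∑ k ∈ H l, min w (1 / (d * k + Real.log 2)) = 0 := by
      intro l _
      rw [hne l, Finset.sum_empty]
    rw [Finset.sum_eq_zero this]
    positivity
  set a := Nat.find hne with ha
  obtain ⟨k₁, hk₁⟩ := Nat.find_spec hne
  rw [← ha] at hk₁
  have hlt : ∀ l < a, H l = ∅ := fun l hl =>
    Finset.not_nonempty_iff_eq_empty.1 (Nat.find_min hne hl)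
  -- the first level
  have hfirst : ∑ k ∈ H a, min w (1 / (d * k + Real.log 2)) ≤ 64 * u / d + w := by
    have hq' := hqR a
    rcases le_or_gt (H a).card 1 with h1 | h1
    · have : ∑ k ∈ H a, min w (1 / (d * k + Real.log 2)) ≤ (H a).card • w :=
        Finset.sum_le_card_nsmul _ _ _ fun k _ => min_le_left _ _
      rw [nsmul_eq_mul] at this
      have h2 : ((H a).card : ℝ) ≤ 1 := by exact_mod_cast h1
      rw [hud']
      nlinarith
    -- Two hits force `2 * q * u ≥ 3 / 4`, so the additive `5 / 4` is absorbed and the cost is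
    -- proportional to `u`.
    · refine (hcost a).trans ?_
      have h2 : (2 : ℝ) ≤ (H a).card := by exact_mod_cast h1
      have h3 := hcard a
      calc ((H a).card : ℝ) * (8 / (d * q a)) ≤ (8 * q a * u) * (8 / (d * q a)) := by
            gcongr; linarith
        _ = 64 * u / d := by field_simp; ring
        _ ≤ _ := by linarith
  -- the later levels
  have hlater : ∀ t, ∑ k ∈ H (a + (t + 1)), min w (1 / (d * k + Real.log 2)) ≤
      64 * u / d + w * (1 / 2) ^ (t + 1) := by
    intro t
    rcases (H (a + (t + 1))).eq_empty_or_nonempty with h | ⟨k, hk⟩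
    · rw [h, Finset.sum_empty]; positivity
    refine (hcost' _).trans ?_
    have hk₁G := hHG _ _ hk₁
    have hkG := hHG _ _ hk
    have hdist := hsep' a (a + (t + 1)) (by omega) k₁ hk₁G k hkG
    have hkk : (k₁ : ℝ) ≤ k := by
      have h1 := (hG _ _ hk₁G).2
      have h2 := (hG _ _ hkG).1
      have h3 := hq a (t + 1)
      have h4 : 16 * q a ≤ 16 ^ (t + 1) * q a :=
        Nat.mul_le_mul_right _ (by rw [pow_succ]; linarith [Nat.one_le_pow t 16 (by norm_num)])
      have h5 : ((16 * q a : ℕ) : ℤ) ≤ q (a + (t + 1)) := by exact_mod_cast h4.trans h3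
      push_cast at h5
      exact_mod_cast (by omega : k₁ ≤ k)
    have hrr : Real.exp (-(d * k)) ≤ Real.exp (-(d * k₁)) := by
      apply Real.exp_le_exp.2
      nlinarith
    -- Reaching both `k₁` and a candidate of a later level means bridging a gap of four times the
    -- radius at `k₁`. Hence `u` is at least that radius, and `w` is at least comparable to `1 / (d
    -- * q a)`, which dominates the later terms `10 / (d * q l)` geometrically.
    have hru : Real.exp (-(d * k₁)) ≤ u := by
      obtain ⟨z, hz1, hz2⟩ := (Finset.mem_filter.1 hk₁).2
      obtain ⟨z', hz1', hz2'⟩ := (Finset.mem_filter.1 hk).2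
      have h1 : |c k₁ - c k| ≤ u + Real.exp (-(d * k₁)) := by
        rw [abs_le]
        constructor <;>
        linarith [hz1.1, hz1.2, hz1'.1, hz1'.2, hz2.1, hz2.2, hz2'.1, hz2'.2,
          Real.exp_pos (-(d * k)), Real.exp_pos (-(d * k₁))]
      linarith [Real.exp_pos (-(d * k₁))]
    have hk₁0 : (0 : ℝ) < k₁ := by
      have h1 := (hG _ _ hk₁G).1
      have h2 : (0 : ℤ) < q a := by exact_mod_cast hq0 a
      exact_mod_cast (by omega : 0 < k₁)
    have hwa : 4 / (d * q a) ≤ w := by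
      have h1 := Real.log_le_log (Real.exp_pos _) hru
      rw [Real.log_exp] at h1
      have h2 : 4 * (k₁ : ℝ) ≤ q a := by exact_mod_cast (hG _ _ hk₁G).2
      rw [hω, ← one_div, div_le_div_iff₀ (by have := hqR a; positivity) hlog]
      nlinarith
    have hq16 : (16 : ℝ) ^ (t + 1) * q a ≤ q (a + (t + 1)) := by exact_mod_cast hq a (t + 1)
    have h10 : 10 / (d * q (a + (t + 1))) ≤ w * (1 / 2) ^ (t + 1) := by
      have h0 := hqR a
      calc 10 / (d * q (a + (t + 1))) ≤ 10 / (d * (16 ^ (t + 1) * q a)) := by gcongr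
        _ = (4 / (d * q a)) * ((5 / 2) * (1 / 16) ^ (t + 1)) := by
          rw [one_div, inv_pow]; field_simp; norm_num
        _ ≤ w * (1 / 2) ^ (t + 1) := by
          gcongr
          rw [pow_succ, pow_succ]
          have : (1 / 16 : ℝ) ^ t ≤ (1 / 2) ^ t := by gcongr; norm_num
          have h3 : (0 : ℝ) ≤ (1 / 2) ^ t := by positivity
          linarith
    rw [hud' 16, hud' 64]
    linarith
  have hall : ∀ l, ∑ k ∈ H l, min w (1 / (d * k + Real.log 2)) ≤
      64 * u / d + (if a ≤ l then w * (1 / 2) ^ (l - a) else 0) := by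
    intro l
    split_ifs with hal
    · obtain ⟨t, rfl⟩ := Nat.exists_eq_add_of_le hal
      rcases t with _ | t
      · simpa using hfirst
      · simpa using hlater t
    · rw [hlt l (by omega), Finset.sum_empty]; positivity
  calc ∑ l ∈ Finset.range M, ∑ k ∈ H l, min w (1 / (d * k + Real.log 2))
      ≤ ∑ l ∈ Finset.range M, (64 * u / d + (if a ≤ l then w * (1 / 2) ^ (l - a) else 0)) :=
        Finset.sum_le_sum fun l _ => hall l
    _ = 64 * M * u / d + w * ∑ l ∈ Finset.Ico a M, (1 / 2 : ℝ) ^ (l - a) := by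
      rw [Finset.sum_add_distrib, Finset.sum_const, Finset.card_range, nsmul_eq_mul,
        ← Finset.sum_filter, Finset.mul_sum]
      congr 1
      · ring
      · apply Finset.sum_congr _ fun _ _ => rfl
        ext l
        simp only [Finset.mem_filter, Finset.mem_range, Finset.mem_Ico]
        omega
    _ ≤ 64 * M * u / d + w * 2 := by
      gcongr
      rw [Finset.sum_Ico_eq_sum_range]
      simp only [add_tsub_cancel_left]
      exact sum_geometric_two_le _
    _ = _ := by ring

/-! ### Gauge against length, and the refinement step -/

/-- The sum of `f i` over the indices for which the interval `(x i, y i)` meets `[a, b]`. -/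
noncomputable def meetSum (x y f : ℕ → ℝ) (a b : ℝ) : ℝ :=
  ∑' i, {i | (Ioo (x i) (y i) ∩ Icc a b).Nonempty}.indicator f i

theorem logGauge_nonneg (s r : ℝ) : 0 ≤ logGauge s r := by
  unfold logGauge
  split_ifs with h
  · exact Real.rpow_nonneg (by linarith [Real.log_neg h.1 h.2]) _
  · exact le_rfl

theorem logGauge_one_of_mem {r : ℝ} (h0 : 0 < r) (h1 : r < 1) :
    logGauge 1 r = (-Real.log r)⁻¹ := by
  rw [logGauge, if_pos ⟨h0, h1⟩, Real.rpow_neg_one]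

/-- This is `√r * log (1 / r) ≤ 2`, from `log t ≤ t - 1` at `t = 1 / √r`. The extra factor `√r`
turns a bound on total gauge into a tiny bound on total length once the intervals are short. -/
theorem le_two_mul_sqrt_mul_logGauge {r : ℝ} (h0 : 0 ≤ r) (h1 : r < 1) :
    r ≤ 2 * √r * logGauge 1 r := by
  rcases h0.eq_or_lt with rfl | h0
  · simp
  rw [logGauge_one_of_mem h0 h1]
  have hlog : 0 < -Real.log r := by linarith [Real.log_neg h0 h1]
  have hs : 0 < √r := Real.sqrt_pos.2 h0
  have h2 : -Real.log √r ≤ 1 / √r := by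
    rw [← Real.log_inv, one_div]
    have := Real.log_le_sub_one_of_pos (inv_pos.2 hs)
    linarith
  rw [Real.log_sqrt h0.le, le_div_iff₀ hs] at h2
  have h3 : r = √r * √r := (Real.mul_self_sqrt h0.le).symm
  rw [← div_eq_mul_inv, le_div_iff₀ hlog]
  nlinarith

theorem le_two_mul_logGauge {r : ℝ} (h0 : 0 ≤ r) (h1 : r < 1) : r ≤ 2 * logGauge 1 r := by
  have h := le_two_mul_sqrt_mul_logGauge h0 h1
  have h2 : √r ≤ 1 := Real.sqrt_le_one.2 h1.le
  nlinarith [logGauge_nonneg 1 r]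

theorem summable_length {x y : ℕ → ℝ} (hxy : ∀ i, x i ≤ y i) (hxy1 : ∀ i, y i - x i < 1)
    (hw : Summable fun i => logGauge 1 (y i - x i)) : Summable fun i => y i - x i :=
  Summable.of_nonneg_of_le (fun i => sub_nonneg.2 (hxy i))
    (fun i => le_two_mul_logGauge (sub_nonneg.2 (hxy i)) (hxy1 i)) (hw.mul_left 2)

theorem eventually_step_conditions {d β l : ℝ} (hd : 0 < d) (hdβ : d < β) (hl : 0 < l) (K K' : ℤ) :
    ∀ᶠ k : ℕ in atTop, Real.exp (-(d * k)) ≤ 1 / (64 * k) ∧ Real.exp (-(d * k)) ≤ l / 2 ∧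
      Real.exp (-(β * k)) ≤ Real.exp (-(d * k)) / 2 ∧ Real.log 2 ≤ d * k ∧ K' < k ∧ K < k ∧
      Real.exp (-(d * k)) / d ≤ l / 10 ^ 6 := by
  have hexp : ∀ {b : ℝ}, 0 < b → Tendsto (fun k : ℕ => Real.exp (-(b * k))) atTop (𝓝 0) := by
    intro b hb
    exact Real.tendsto_exp_neg_atTop_nhds_zero.comp
      (tendsto_natCast_atTop_atTop.const_mul_atTop hb)
  have h1 : ∀ᶠ k : ℕ in atTop, Real.exp (-(d * k)) ≤ 1 / (64 * k) := by
    have h := (Real.tendsto_pow_mul_exp_neg_atTop_nhds_zero 1).comp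
      (tendsto_natCast_atTop_atTop.const_mul_atTop hd : Tendsto (fun k : ℕ => d * (k : ℝ)) _ _)
    filter_upwards [h.eventually_le_const (show 0 < d / 64 by positivity), eventually_gt_atTop 0]
      with k hk hk0
    have hk0' : (0 : ℝ) < k := by exact_mod_cast hk0
    simp only [Function.comp_apply, pow_one] at hk
    rw [le_div_iff₀ (by positivity)]
    have : d * (k * Real.exp (-(d * k))) ≤ d * (1 / 64) := by linarith
    have := le_of_mul_le_mul_left this hd
    linarith
  have h3 := (hexp (sub_pos.2 hdβ)).eventually_le_const (show (0 : ℝ) < 1 / 2 by norm_num)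
  filter_upwards [h1, (hexp hd).eventually_le_const (show 0 < l / 2 by positivity), h3,
    (tendsto_natCast_atTop_atTop.const_mul_atTop hd :
      Tendsto (fun k : ℕ => d * (k : ℝ)) _ _).eventually_ge_atTop (Real.log 2),
    eventually_gt_atTop K'.toNat, eventually_gt_atTop K.toNat,
    (hexp hd).eventually_le_const (show 0 < l / 10 ^ 6 * d by positivity)]
    with k h1 h2 h3 h4 h5 h6 h7
  refine ⟨h1, h2, ?_, h4, by omega, by omega, ?_⟩
  · have : Real.exp (-(β * k)) = Real.exp (-((β - d) * k)) * Real.exp (-(d * k)) := by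
      rw [← Real.exp_add]; congr 1; ring
    rw [this]
    nlinarith [Real.exp_pos (-(d * k))]
  · rwa [div_le_iff₀ hd]

/-- The ratio 16 puts the index bands of distinct levels in increasing order and gives the geometric
decay used in `sum_cost_le`. -/
theorem exists_sparse_seq {P : ℕ → Prop} (hP : ∀ N, ∃ q, N ≤ q ∧ P q) :
    ∃ q : ℕ → ℕ, (∀ l, P (q l)) ∧ ∀ l t, 16 ^ t * q l ≤ q (l + t) := by
  obtain ⟨q, hq, hq'⟩ := exists_seq_of_forall_finset_exists P (fun a b => 16 * a ≤ b) (by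
    intro s _
    obtain ⟨q, hq, hPq⟩ := hP (16 * s.sup id)
    refine ⟨q, hPq, fun a ha => ?_⟩
    have : a ≤ s.sup id := Finset.le_sup (f := id) ha
    omega)
  refine ⟨q, hq, fun l t => ?_⟩
  induction t with
  | zero => simp
  | succ t ih =>
    have := hq' (l + t) (l + (t + 1)) (by omega)
    rw [pow_succ]
    linarith

/-- Either one interval alone attains the cap `ω`, or the cap changes nothing. Capping keeps a long
covering interval from paying its full gauge to every candidate it meets. -/
theorem le_meetSum_min {x y w : ℕ → ℝ} (hw : Summable w) (hw0 : ∀ i, 0 ≤ w i) {a b ω : ℝ}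
    (hω : 0 ≤ ω) (h : 1 / 2 * ω < meetSum x y w a b) :
    1 / 2 * ω ≤ meetSum x y (fun i => min (w i) ω) a b := by
  have hmin : Summable fun i => min (w i) ω :=
    Summable.of_nonneg_of_le (fun i => le_min (hw0 i) hω) (fun i => min_le_left _ _) hw
  by_cases hex : ∃ i, (Ioo (x i) (y i) ∩ Icc a b).Nonempty ∧ ω ≤ w i
  · obtain ⟨i, hi, hωi⟩ := hex
    have h1 := (hmin.indicator {i | (Ioo (x i) (y i) ∩ Icc a b).Nonempty}).le_tsum i
      (fun j _ => indicator_nonneg (fun j _ => le_min (hw0 j) hω) j)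
    rw [indicator_of_mem (by exact hi), min_eq_right hωi] at h1
    exact le_trans (by linarith) h1
  · push Not at hex
    refine h.le.trans_eq ?_
    unfold meetSum
    congr 1
    ext i
    by_cases hi : i ∈ {i | (Ioo (x i) (y i) ∩ Icc a b).Nonempty}
    · rw [indicator_of_mem hi, indicator_of_mem hi, min_eq_left (hex i hi).le]
    · rw [indicator_of_notMem hi, indicator_of_notMem hi]

open Classical in
/-- Refinement step: an interval on which the cover has small total length contains a short
interval to one side of an orbit point `kα`, which keeps away from the orbit points with index
between `K` and `k`, and on which the cover has small total gauge. -/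
theorem exists_refinement {α : ℝ} (hα : Irrational α) {x y : ℕ → ℝ} (hxy : ∀ i, x i ≤ y i)
    (hxy1 : ∀ i, y i - x i < 1) (hw : Summable fun i => logGauge 1 (y i - x i)) {a l : ℝ}
    (hl : 0 < l) (hl1 : l ≤ 1) (hsum : meetSum x y (fun i => y i - x i) a (a + l) ≤ l / 10 ^ 6)
    {d β : ℝ} (hd : 0 < d) (hdβ : d < β) {K : ℤ} (hK : 0 ≤ K)
    (hKl : Real.exp (-(β * K)) / β ≤ l / 10 ^ 6) (K' : ℤ) :
    ∃ k n : ℤ, K' < k ∧ K < k ∧ a ≤ k * α + n ∧ k * α + n + Real.exp (-(d * k)) ≤ a + l ∧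
      (∀ z ∈ Icc (k * α + n + Real.exp (-(d * k)) / 2) (k * α + n + Real.exp (-(d * k))),
        ∀ m : ℤ, K < |m| → |m| ≤ k → ∀ e : ℤ,
          Real.exp (-(β * |(m : ℝ)|)) ≤ |z - m * α - e|) ∧
      meetSum x y (fun i => logGauge 1 (y i - x i)) (k * α + n + Real.exp (-(d * k)) / 2)
        (k * α + n + Real.exp (-(d * k))) ≤ 1 / 2 * (1 / (d * k + Real.log 2)) := by
  have hβ : 0 < β := hd.trans hdβ
  obtain ⟨Q, hQ⟩ := eventually_atTop.1 (eventually_step_conditions hd hdβ hl K K')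
  have hQl := (hQ Q le_rfl).2.2.2.2.2.2
  -- The first term secures the avoidance at rate `β`; the second keeps candidates of different
  -- levels four radii apart, as `sum_cost_le` needs. Starting the second at `Q` makes its sum small
  -- against `l`.
  set ρ : ℤ → ℝ := fun m => 2 * (if K < |m| then Real.exp (-(β * |(m : ℝ)|)) else 0) +
    4 * (if (Q : ℤ) < |m| then Real.exp (-(d * |(m : ℝ)|)) else 0) with hρ
  have hρ0 : ∀ m, 0 ≤ ρ m := fun m => by simp only [hρ]; positivity
  have hρl : ∀ s : Finset ℤ, ∑ m ∈ s, ρ m ≤ l / 2 / 3200 := by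
    intro s
    have h1 := sum_exp_neg_abs_le hβ hK s
    have h2 := sum_exp_neg_abs_le hd (Int.natCast_nonneg Q) s
    rw [Int.cast_natCast] at h2
    simp only [hρ]
    rw [Finset.sum_add_distrib, ← Finset.mul_sum, ← Finset.mul_sum]
    linarith
  obtain ⟨N, hN⟩ := exists_forall_card_selected_ge hα a (half_pos hl) (by linarith) ρ hρ0 hρl
  obtain ⟨q, hqP, hq16⟩ := exists_sparse_seq
    (P := fun q => IsDirichletDen α q ∧ N ≤ q ∧ 8 * (Q + 1) ≤ q) (by
      intro M
      obtain ⟨q, hq, hq'⟩ := exists_isDirichletDen_ge hα (M + N + 8 * (Q + 1))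
      exact ⟨q, by omega, hq', by omega, by omega⟩)
  set G : ℕ → Finset ℤ := fun j => (band (q j)).filter fun k : ℤ =>
    (∃ n : ℤ, (k * α + n : ℝ) ∈ Icc a (a + l / 2)) ∧
        ∀ m : ℤ, 4 * |m| ≤ q j → k ≠ m → ∀ n : ℤ, ρ m ≤ |((k - m : ℤ) : ℝ) * α - n| with hGdef
  have hGmem : ∀ j, ∀ k ∈ G j, ((q j : ℤ) ≤ 8 * k ∧ 4 * k ≤ q j) ∧
      (∃ n : ℤ, (k * α + n : ℝ) ∈ Icc a (a + l / 2)) ∧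
        ∀ m : ℤ, 4 * |m| ≤ q j → k ≠ m → ∀ n : ℤ, ρ m ≤ |((k - m : ℤ) : ℝ) * α - n| := by
    intro j k hk
    rwa [hGdef, Finset.mem_filter, mem_band] at hk
  have hGcard : ∀ j, l / 2 * q j / 400 ≤ ((G j).card : ℝ) := fun j => hN _ (hqP j).2.1 (hqP j).1
  have hn : ∀ k : ℤ, ∃ n : ℤ, (∃ n : ℤ, (k * α + n : ℝ) ∈ Icc a (a + l / 2)) →
      (k * α + n : ℝ) ∈ Icc a (a + l / 2) := fun k => by
    by_cases h : ∃ n : ℤ, (k * α + n : ℝ) ∈ Icc a (a + l / 2)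
    · exact ⟨h.choose, fun _ => h.choose_spec⟩
    · exact ⟨0, fun h' => absurd h' h⟩
  choose n hn using hn
  set c : ℤ → ℝ := fun k => k * α + n k with hc
  have hqR : ∀ j, (0 : ℝ) < q j := fun j => by exact_mod_cast (hqP j).1.1
  have hlarge : ∀ j, ∀ k ∈ G j, (Q : ℤ) < k ∧ Real.exp (-(d * k)) ≤ 1 / (64 * k) ∧
      Real.exp (-(d * k)) ≤ l / 2 ∧
      Real.exp (-(β * k)) ≤ Real.exp (-(d * k)) / 2 ∧ Real.log 2 ≤ d * k ∧ K' < k ∧ K < k := by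
    intro j k hk
    have h1 := (hGmem j k hk).1.1
    have h2 := (hqP j).2.2
    lift k to ℕ using by omega
    obtain ⟨h3, h4, h5, h6, h7, h8, -⟩ := hQ k (by omega)
    exact ⟨by omega, h3, h4, h5, h6, h7, h8⟩
  have hkpos : ∀ j, ∀ k ∈ G j, (0 : ℝ) < k := fun j k hk => by
    have := (hlarge j k hk).1
    exact_mod_cast (by omega : 0 < k)
  have hr : ∀ j, ∀ k ∈ G j, Real.exp (-(d * k)) ≤ 1 / (8 * q j) := by
    intro j k hk
    refine (hlarge j k hk).2.1.trans ?_
    have h1 : (q j : ℝ) ≤ 8 * k := by exact_mod_cast (hGmem j k hk).1.1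
    have := hqR j
    apply one_div_le_one_div_of_le (by positivity)
    linarith
  have hsep : ∀ j, ∀ k ∈ G j, ∀ m : ℤ, 4 * |m| ≤ q j → k ≠ m → ∀ e : ℤ,
      1 / (2 * (q j : ℝ)) ≤ |c k - m * α - e| := by
    intro j k hk m hm hkm e
    have h1 := (hGmem j k hk).1
    have hm' := abs_le.1 (by omega : |m| ≤ q j / 4)
    refine ((hqP j).1.le_abs_sub (sub_ne_zero.2 hkm) (by
      have : |k - m| ≤ q j / 2 := abs_le.2 ⟨by omega, by omega⟩
      omega) (e - n k)).trans_eq ?_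
    simp only [hc]
    push_cast
    congr 1
    ring
  have hρsep : ∀ j, ∀ k ∈ G j, ∀ m : ℤ, 4 * |m| ≤ q j → k ≠ m → ∀ e : ℤ,
      ρ m ≤ |c k - m * α - e| := by
    intro j k hk m hm hkm e
    refine ((hGmem j k hk).2.2 m hm hkm (e - n k)).trans_eq ?_
    simp only [hc]
    push_cast
    congr 1
    ring
  have hcmem : ∀ j, ∀ k ∈ G j, c k ∈ Icc a (a + l / 2) := fun j k hk => hn k (hGmem j k hk).2.1
  have havoid : ∀ j, ∀ k ∈ G j, ∀ z ∈ Icc (c k + Real.exp (-(d * k)) / 2)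
      (c k + Real.exp (-(d * k))), ∀ m : ℤ, K < |m| → |m| ≤ k → ∀ e : ℤ,
          Real.exp (-(β * |(m : ℝ)|)) ≤ |z - m * α - e| := by
    intro j k hk z hz m hKm hmk e
    obtain ⟨h1, h2, h3, h4, h5, h6, h7⟩ := hlarge j k hk
    have hr' := hr j k hk
    have hq0 := hqR j
    have hk0 := hkpos j k hk
    -- For `m = k` the interval starts at distance `r / 2` from its own orbit point, `r = exp (-(d *
    -- k))`, which is why only its outer half is used. For other `m` the displacement from `c k` is
    -- at most a quarter of the orbit spacing.
    by_cases hkm : k = m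
    · subst hkm
      rw [abs_of_pos hk0]
      refine h4.trans ?_
      have hr1 : Real.exp (-(d * k)) ≤ 1 / 2 := by linarith
      rcases eq_or_ne e (n k) with rfl | hne
      · rw [le_abs]
        left
        have := hz.1
        simp only [hc] at this
        linarith
      · have he : (1 : ℝ) ≤ |((n k - e : ℤ) : ℝ)| := by
          exact_mod_cast Int.one_le_abs (sub_ne_zero.2 hne.symm)
        have hz' : |z - c k| ≤ Real.exp (-(d * k)) := abs_le.2
          ⟨by linarith [hz.1, Real.exp_pos (-(d * k))], by linarith [hz.2]⟩
        have h8 : z - k * α - e = (n k - e : ℤ) + (z - c k) := by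
          simp only [hc]; push_cast; ring
        have h9 := abs_sub_abs_le_abs_add ((n k - e : ℤ) : ℝ) (z - c k)
        rw [h8]
        linarith
    · have hm4 : 4 * |m| ≤ q j := by have := (hGmem j k hk).1.2; omega
      have h8 := hsep j k hk m hm4 hkm e
      have h9 := hρsep j k hk m hm4 hkm e
      have h10 : 2 * Real.exp (-(β * |(m : ℝ)|)) ≤ ρ m := by
        simp only [hρ]
        rw [if_pos hKm]
        exact le_add_of_nonneg_right (by positivity)
      have hz' : |z - c k| ≤ Real.exp (-(d * k)) := abs_le.2
          ⟨by linarith [hz.1, Real.exp_pos (-(d * k))], by linarith [hz.2]⟩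
      have h11 : z - m * α - e = (c k - m * α - e) + (z - c k) := by ring
      have h12 := abs_sub_abs_le_abs_add (c k - m * α - e) (z - c k)
      have h13 : 1 / (8 * (q j : ℝ)) = 1 / (2 * (q j : ℝ)) / 4 := by field_simp; norm_num
      rw [h11]
      rw [h13] at hr'
      linarith [Real.exp_pos (-(β * |(m : ℝ)|))]
  -- If every candidate carries too much gauge, the capped gauge is summed over all candidates of
  -- `M` levels and the two orders of summation are compared.
  by_contra hcon
  push Not at hcon
  set w : ℕ → ℝ := fun i => logGauge 1 (y i - x i) with hwdef
  have hw0 : ∀ i, 0 ≤ w i := fun i => logGauge_nonneg _ _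
  have hω0 : ∀ j, ∀ k ∈ G j, 0 ≤ 1 / (d * k + Real.log 2) := fun j k hk => by
    have := hkpos j k hk
    have := Real.log_pos (show (1 : ℝ) < 2 by norm_num)
    positivity
  have hbad : ∀ j, ∀ k ∈ G j, 1 / 2 * (1 / (d * k + Real.log 2)) ≤
      meetSum x y (fun i => min (w i) (1 / (d * k + Real.log 2)))
        (c k + Real.exp (-(d * k)) / 2) (c k + Real.exp (-(d * k))) := by
    intro j k hk
    obtain ⟨h1, h2, h3, h4, h5, h6, h7⟩ := hlarge j k hk
    apply le_meetSum_min hw hw0 (hω0 j k hk)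
    exact hcon k (n k) h6 h7 (hcmem j k hk).1 (by linarith [(hcmem j k hk).2]) (havoid j k hk)
  set A : ℤ → Set ℕ := fun k => {i | (Ioo (x i) (y i) ∩ Icc (c k + Real.exp (-(d * k)) / 2)
    (c k + Real.exp (-(d * k)))).Nonempty} with hA
  set f : ℤ → ℕ → ℝ := fun k => (A k).indicator fun i => min (w i) (1 / (d * k + Real.log 2))
    with hf
  have hfs : ∀ j, ∀ k ∈ G j, Summable (f k) := fun j k hk =>
    (Summable.of_nonneg_of_le (fun i => le_min (hw0 i) (hω0 j k hk)) (fun i => min_le_left _ _)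
      hw).indicator _
  have hus := summable_length hxy hxy1 hw
  set I : Set ℕ := {i | (Ioo (x i) (y i) ∩ Icc a (a + l)).Nonempty} with hI
  set T := ∑' i, w i with hT
  have hT0 : 0 ≤ T := tsum_nonneg hw0
  have hcost : ∀ M : ℕ, ∀ i, ∑ j ∈ Finset.range M, ∑ k ∈ G j, f k i ≤
      64 * M / d * I.indicator (fun i => y i - x i) i + 2 * w i := by
    intro M i
    by_cases hi : i ∈ I
    · rw [indicator_of_mem hi]
      obtain ⟨z, hz, -⟩ := hi
      have hlt : x i < y i := hz.1.trans hz.2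
      refine le_trans (le_of_eq ?_) ((sum_cost_le (M := M) (fun j => (hqP j).1.1) hq16 (G := G)
        (c := c) hd (fun j k hk => (hGmem j k hk).1) hr ?_ ?_ hlt (hxy1 i)).trans_eq ?_)
      · refine Finset.sum_congr rfl fun j _ => ?_
        refine Eq.trans ?_ (Finset.sum_filter _ _).symm
        refine Finset.sum_congr rfl fun k _ => ?_
        simp only [hf, hA, indicator_apply, Set.mem_ofPred_eq]
        rfl
      · intro j k hk k' hk' hne
        have h1 := (hGmem j k' hk').1
        have := hsep j k hk k' (by rw [abs_of_nonneg (by omega)]; omega) hne (n k')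
        simpa only [hc, sub_sub] using this
      · intro j j' hjj k hk k' hk'
        have h1 := (hGmem j k hk).1
        have h2 := (hGmem j' k' hk').1
        have h3 : 16 * q j ≤ q j' := by
          have h4 := hq16 j (j' - j)
          rw [Nat.add_sub_cancel' hjj.le] at h4
          refine le_trans (Nat.mul_le_mul_right _ ?_) h4
          exact Nat.le_self_pow (by omega) 16
        have hq0 := (hqP j).1.1
        have hQk := (hlarge j k hk).1
        have h5 := hρsep j' k' hk' k (by rw [abs_of_nonneg (by omega)]; omega) (by omega) (n k)
        have h6 : 4 * Real.exp (-(d * k)) ≤ ρ k := by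
          simp only [hρ]
          rw [abs_of_nonneg (by omega : 0 ≤ k), if_pos hQk, abs_of_pos (hkpos j k hk)]
          exact le_add_of_nonneg_left (by positivity)
        rw [abs_sub_comm]
        refine h6.trans (h5.trans_eq ?_)
        simp only [hc, sub_sub]
      · simp only [hwdef]; ring
    · rw [indicator_of_notMem hi]
      have hz : ∀ j ∈ Finset.range M, ∑ k ∈ G j, f k i = 0 := fun j _ =>
        Finset.sum_eq_zero fun k hk => by
          simp only [hf]
          apply indicator_of_notMem
          rintro ⟨z, hz1, hz2⟩
          refine hi ⟨z, hz1, ?_, ?_⟩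
          · linarith [hz2.1, (hcmem j k hk).1, Real.exp_pos (-(d * k))]
          · linarith [hz2.2, (hcmem j k hk).2, (hlarge j k hk).2.2.1]
      rw [Finset.sum_eq_zero hz]
      have := hw0 i
      linarith
  have hupper : ∀ M : ℕ, ∑ j ∈ Finset.range M, ∑ k ∈ G j, ∑' i, f k i ≤
      64 * M / d * (l / 10 ^ 6) + 2 * T := by
    intro M
    have h1 : ∑ j ∈ Finset.range M, ∑ k ∈ G j, ∑' i, f k i =
        ∑' i, ∑ j ∈ Finset.range M, ∑ k ∈ G j, f k i := by
      rw [Summable.tsum_finsetSum fun j _ => summable_sum fun k hk => hfs j k hk]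
      exact Finset.sum_congr rfl fun j _ => (Summable.tsum_finsetSum fun k hk => hfs j k hk).symm
    have hs1 := (hus.indicator I).mul_left (64 * M / d)
    rw [h1]
    calc _ ≤ ∑' i, (64 * M / d * I.indicator (fun i => y i - x i) i + 2 * w i) :=
          Summable.tsum_le_tsum (hcost M)
            (summable_sum fun j _ => summable_sum fun k hk => hfs j k hk)
            (hs1.add (hw.mul_left 2))
      _ = 64 * M / d * meetSum x y (fun i => y i - x i) a (a + l) + 2 * T := by
          rw [hs1.tsum_add (hw.mul_left 2), tsum_mul_left, tsum_mul_left]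
          rfl
      _ ≤ _ := by gcongr
  have hlower : ∀ M : ℕ, M * (l / (800 * d)) ≤ ∑ j ∈ Finset.range M, ∑ k ∈ G j, ∑' i, f k i := by
    intro M
    have : ∀ j ∈ Finset.range M, l / (800 * d) ≤ ∑ k ∈ G j, ∑' i, f k i := by
      intro j _
      have h0 := hqR j
      have h1 : ∀ k ∈ G j, 1 / (d * q j) ≤ ∑' i, f k i := by
        intro k hk
        refine le_trans ?_ (hbad j k hk)
        have h2 : 4 * (k : ℝ) ≤ q j := by exact_mod_cast (hGmem j k hk).1.2
        have h3 := (hlarge j k hk).2.2.2.2.1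
        have h4 := hkpos j k hk
        have h5 : 0 < Real.log 2 := Real.log_pos (by norm_num)
        rw [one_div_mul_one_div]
        apply one_div_le_one_div_of_le (by positivity)
        nlinarith
      calc l / (800 * d) = (l / 2 * q j / 400) * (1 / (d * q j)) := by field_simp; ring
        _ ≤ (G j).card * (1 / (d * q j)) := by gcongr; exact hGcard j
        _ ≤ _ := by
          rw [← nsmul_eq_mul]
          exact Finset.card_nsmul_le_sum _ _ _ h1
    calc M * (l / (800 * d)) = ∑ j ∈ Finset.range M, l / (800 * d) := by simp
      _ ≤ _ := Finset.sum_le_sum this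
  -- The comparison fails since `1 / 800 > 64 / 10 ^ 6 + 1 / 1000`, the last term accounting for `2
  -- * T`.
  obtain ⟨M, hM⟩ := exists_nat_gt (2 * T / (l / d * (1 / 1000)))
  have hld : 0 < l / d := by positivity
  rw [div_lt_iff₀ (by positivity)] at hM
  have h1 := (hlower M).trans (hupper M)
  have h2 : M * (l / (800 * d)) = M * (l / d) * (1 / 800) := by field_simp
  have h3 : 64 * M / d * (l / 10 ^ 6) = M * (l / d) * (64 / 10 ^ 6) := by field_simp
  rw [h2, h3] at h1
  have h4 : 0 ≤ M * (l / d) := by positivity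
  nlinarith

/-! ### Nested intervals escaping the cover -/

theorem le_meetSum {x y f : ℕ → ℝ} (hf : Summable f) (hf0 : ∀ i, 0 ≤ f i) {a b : ℝ} {i : ℕ}
    (hi : (Ioo (x i) (y i) ∩ Icc a b).Nonempty) : f i ≤ meetSum x y f a b := by
  have h1 := (hf.indicator {i | (Ioo (x i) (y i) ∩ Icc a b).Nonempty}).le_tsum i
    (fun j _ => indicator_nonneg (fun j _ => hf0 j) j)
  rwa [indicator_of_mem (by exact hi)] at h1

/-- If the intervals meeting `[a, b]` have small total gauge compared with the gauge of `r`, then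
their total length is small compared with `r`. -/
theorem meetSum_length_le {x y : ℕ → ℝ} (hxy : ∀ i, x i ≤ y i) (hxy1 : ∀ i, y i - x i < 1)
    (hw : Summable fun i => logGauge 1 (y i - x i)) {a b r : ℝ} (hr : 0 < r)
    (hL : 10 ^ 6 ≤ -Real.log r)
    (h : meetSum x y (fun i => logGauge 1 (y i - x i)) a b ≤ 1 / 2 * (1 / -Real.log r)) :
    meetSum x y (fun i => y i - x i) a b ≤ r / 10 ^ 6 := by
  have hus := summable_length hxy hxy1 hw
  have hL0 : 0 < -Real.log r := by linarith [show (0 : ℝ) < 10 ^ 6 by norm_num]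
  set A := {i | (Ioo (x i) (y i) ∩ Icc a b).Nonempty} with hA
  have hle : ∀ i, A.indicator (fun i => y i - x i) i ≤
      2 * r * A.indicator (fun i => logGauge 1 (y i - x i)) i := by
    intro i
    by_cases hi : i ∈ A
    · rw [indicator_of_mem hi, indicator_of_mem hi]
      have h1 := (le_meetSum hw (fun i => logGauge_nonneg _ _) hi).trans h
      obtain ⟨z, hz, -⟩ := hi
      have hu : 0 < y i - x i := sub_pos.2 (hz.1.trans hz.2)
      have hlog : 0 < -Real.log (y i - x i) := by linarith [Real.log_neg hu (hxy1 i)]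
      rw [logGauge_one_of_mem hu (hxy1 i), one_div_mul_one_div, ← one_div,
        one_div_le_one_div hlog (by positivity)] at h1
      -- A gauge at most half that of `r` means the logarithm at least doubles, so the length is at
      -- most `r ^ 2`.
      have h2 : √(y i - x i) ≤ r := by
        rw [Real.sqrt_le_left hr.le, ← Real.log_le_log_iff hu (by positivity), Real.log_pow]
        push_cast
        linarith
      refine (le_two_mul_sqrt_mul_logGauge hu.le (hxy1 i)).trans ?_
      have := logGauge_nonneg 1 (y i - x i)
      gcongr
    · rw [indicator_of_notMem hi, indicator_of_notMem hi, mul_zero]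
  have hs := (hw.indicator A).mul_left (2 * r)
  calc meetSum x y (fun i => y i - x i) a b
      ≤ ∑' i, 2 * r * A.indicator (fun i => logGauge 1 (y i - x i)) i :=
        Summable.tsum_le_tsum hle (hus.indicator A) hs
    _ = 2 * r * meetSum x y (fun i => logGauge 1 (y i - x i)) a b := tsum_mul_left
    _ ≤ 2 * r * (1 / 2 * (1 / -Real.log r)) := by gcongr
    _ ≤ 2 * r * (1 / 2 * (1 / 10 ^ 6)) := by gcongr
    _ = r / 10 ^ 6 := by ring

/-- Since `d < β`, the neighbourhoods still to be avoided beyond `k` become negligible against the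
new interval, of length `exp (-(d * k)) / 2`. -/
theorem eventually_tail_conditions {d β : ℝ} (hd : 0 < d) (hdβ : d < β) :
    ∀ᶠ k : ℕ in atTop, 10 ^ 6 ≤ d * k + Real.log 2 ∧
      Real.exp (-(β * k)) / β ≤ Real.exp (-(d * k)) / 2 / 10 ^ 6 := by
  have hβ : 0 < β := hd.trans hdβ
  have h1 : Tendsto (fun k : ℕ => Real.exp (-((β - d) * k))) atTop (𝓝 0) :=
    Real.tendsto_exp_neg_atTop_nhds_zero.comp
      (tendsto_natCast_atTop_atTop.const_mul_atTop (sub_pos.2 hdβ))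
  filter_upwards [h1.eventually_le_const (show 0 < β / 2 / 10 ^ 6 by positivity),
    (tendsto_natCast_atTop_atTop.const_mul_atTop hd :
      Tendsto (fun k : ℕ => d * (k : ℝ)) _ _).eventually_ge_atTop (10 ^ 6)] with k h2 h3
  refine ⟨by linarith [Real.log_pos (show (1 : ℝ) < 2 by norm_num)], ?_⟩
  have : Real.exp (-(β * k)) = Real.exp (-((β - d) * k)) * Real.exp (-(d * k)) := by
    rw [← Real.exp_add]; congr 1; ring
  rw [this, div_le_iff₀ hβ]
  nlinarith [Real.exp_pos (-(d * k))]

/-- An interval `[a, a + l]` with an index `K` from which the refinement step can be made. -/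
structure IsAdmissible (x y : ℕ → ℝ) (β : ℝ) (s : ℝ × ℝ × ℤ) : Prop where
  pos : 0 < s.2.1
  left : 1 / 4 ≤ s.1
  right : s.1 + s.2.1 ≤ 3 / 4
  sum_le : meetSum x y (fun i => y i - x i) s.1 (s.1 + s.2.1) ≤ s.2.1 / 10 ^ 6
  index_nonneg : 0 ≤ s.2.2
  tail_le : Real.exp (-(β * s.2.2)) / β ≤ s.2.1 / 10 ^ 6

/-- `t` is a refinement of `s`, approximating with rate `d` and avoiding with rate `β`. -/
structure IsRefinement (α d β : ℝ) (s t : ℝ × ℝ × ℤ) : Prop where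
  left : s.1 ≤ t.1
  right : t.1 + t.2.1 ≤ s.1 + s.2.1
  length_le : t.2.1 ≤ s.2.1 / 2
  index_lt : s.2.2 < t.2.2
  near : ∀ z ∈ Icc t.1 (t.1 + t.2.1), ∃ n : ℤ, |z - t.2.2 * α - n| ≤ Real.exp (-(d * t.2.2))
  far : ∀ z ∈ Icc t.1 (t.1 + t.2.1), ∀ m : ℤ, s.2.2 < |m| → |m| ≤ t.2.2 → ∀ e : ℤ,
    Real.exp (-(β * |(m : ℝ)|)) ≤ |z - m * α - e|

theorem IsAdmissible.exists_isRefinement {α : ℝ} (hα : Irrational α) {x y : ℕ → ℝ}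
    (hxy : ∀ i, x i ≤ y i) (hxy1 : ∀ i, y i - x i < 1)
    (hw : Summable fun i => logGauge 1 (y i - x i)) {d β β' : ℝ} (hd : 0 < d) (hdβ : d < β)
    (hdβ' : d < β') {s : ℝ × ℝ × ℤ} (hs : IsAdmissible x y β s) :
    ∃ t, IsAdmissible x y β' t ∧ IsRefinement α d β s t := by
  obtain ⟨a, l, K⟩ := s
  obtain ⟨hl, ha, hal, hsum, hK, hKl⟩ := hs
  dsimp only at hl ha hal hsum hK hKl
  obtain ⟨Q, hQ⟩ := eventually_atTop.1 (eventually_tail_conditions hd hdβ')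
  obtain ⟨k, n, hQk, hKk, h1, h2, h3, h4⟩ := exists_refinement hα hxy hxy1 hw hl (by linarith)
    hsum hd hdβ hK hKl Q
  obtain ⟨h5, h6⟩ : 10 ^ 6 ≤ d * k + Real.log 2 ∧
      Real.exp (-(β' * k)) / β' ≤ Real.exp (-(d * k)) / 2 / 10 ^ 6 := by
    lift k to ℕ using by omega
    exact hQ k (by omega)
  have hr := Real.exp_pos (-(d * k))
  have hend : k * α + n + Real.exp (-(d * k)) / 2 + Real.exp (-(d * k)) / 2 =
      k * α + n + Real.exp (-(d * k)) := by ring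
  have hlog : -Real.log (Real.exp (-(d * k)) / 2) = d * k + Real.log 2 := by
    rw [Real.log_div hr.ne' two_ne_zero, Real.log_exp]; ring
  refine ⟨⟨k * α + n + Real.exp (-(d * k)) / 2, Real.exp (-(d * k)) / 2, k⟩,
    ⟨by positivity, ?_, ?_, ?_, by dsimp only; omega, h6⟩, ⟨?_, ?_, ?_, hKk, ?_, ?_⟩⟩ <;>
    dsimp only
  · linarith
  · linarith
  · rw [hend]
    exact meetSum_length_le hxy hxy1 hw (by positivity) (by rwa [hlog]) (by rwa [hlog])
  · linarith
  · linarith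
  · linarith
  · rw [hend]
    intro z hz
    refine ⟨n, ?_⟩
    rw [abs_le]
    constructor <;> linarith [hz.1, hz.2]
  · rw [hend]
    exact h3

/-- A cover of small total length by intervals of finite total gauge misses a point with
prescribed approximation properties. -/
theorem exists_notMem_cover {α : ℝ} (hα : Irrational α) {x y : ℕ → ℝ}
    (hxy : ∀ i, x i ≤ y i) (hxy1 : ∀ i, y i - x i < 1)
    (hw : Summable fun i => logGauge 1 (y i - x i))
    (hsum : ∑' i, (y i - x i) ≤ 1 / 2 / 10 ^ 6) {d β : ℕ → ℝ} (hd : ∀ j, 0 < d j)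
    (hdβ : ∀ j, d j < β j) (hdβ' : ∀ j, d (j + 1) < β j) (hβ : 10 ^ 7 ≤ β 0) :
    ∃ z ∈ Icc (1 / 4 : ℝ) (3 / 4), (∀ i, z ∉ Ioo (x i) (y i)) ∧ ∃ K : ℕ → ℤ, StrictMono K ∧
      K 0 = 0 ∧
      (∀ j, ∃ n : ℤ, |z - K (j + 1) * α - n| ≤ Real.exp (-(d (j + 1) * K (j + 1)))) ∧
      ∀ j, ∀ m : ℤ, K j < |m| → |m| ≤ K (j + 1) → ∀ e : ℤ,
        Real.exp (-(β j * |(m : ℝ)|)) ≤ |z - m * α - e| := by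
  have hus := summable_length hxy hxy1 hw
  have hu0 : ∀ i, 0 ≤ y i - x i := fun i => sub_nonneg.2 (hxy i)
  have hstep : ∀ (j : ℕ) (s : ℝ × ℝ × ℤ), ∃ t, IsAdmissible x y (β j) s →
      IsAdmissible x y (β (j + 1)) t ∧ IsRefinement α (d (j + 1)) (β j) s t := by
    intro j s
    by_cases hs : IsAdmissible x y (β j) s
    · obtain ⟨t, ht⟩ := hs.exists_isRefinement hα hxy hxy1 hw (hd (j + 1)) (hdβ' j) (hdβ (j + 1))
      exact ⟨t, fun _ => ht⟩
    · exact ⟨s, fun h => absurd h hs⟩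
  choose next hnext using hstep
  set f : ℕ → ℝ × ℝ × ℤ := fun j => Nat.rec (1 / 4, 1 / 2, 0) next j with hf
  have hfs : ∀ j, f (j + 1) = next j (f j) := fun j => rfl
  have h0 : IsAdmissible x y (β 0) (f 0) := by
    refine ⟨by norm_num [hf], by norm_num [hf], by norm_num [hf], ?_, by norm_num [hf], ?_⟩
    · refine le_trans ?_ hsum
      exact (hus.indicator _).tsum_le_tsum (fun i => indicator_le_self' (fun i _ => hu0 i) i) hus
    · have hf0 : f 0 = (1 / 4, 1 / 2, 0) := rfl
      rw [hf0]
      simp only [Int.cast_zero, mul_zero, neg_zero, Real.exp_zero]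
      rw [div_le_iff₀ (by linarith [show (0 : ℝ) < 10 ^ 7 by norm_num])]
      linarith
  have hadm : ∀ j, IsAdmissible x y (β j) (f j) := by
    intro j
    induction j with
    | zero => exact h0
    | succ j ih => rw [hfs]; exact (hnext j _ ih).1
  have href : ∀ j, IsRefinement α (d (j + 1)) (β j) (f j) (f (j + 1)) := fun j => by
    rw [hfs]; exact (hnext j _ (hadm j)).2
  have hanti : Antitone fun j => Icc (f j).1 ((f j).1 + (f j).2.1) :=
    antitone_nat_of_succ_le fun j => Icc_subset_Icc (href j).left (href j).right
  have hz := ciSup_mem_iInter_Icc_of_antitone_Icc hanti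
    (fun j => le_add_of_nonneg_right (hadm j).pos.le)
  set z := ⨆ j, (f j).1
  rw [mem_iInter] at hz
  have hlen : ∀ j, (f j).2.1 ≤ (1 / 2) ^ j := by
    intro j
    induction j with
    | zero => norm_num [hf]
    | succ j ih => rw [pow_succ]; linarith [(href j).length_le]
  refine ⟨z, ⟨(hadm 0).left.trans (hz 0).1, (hz 0).2.trans (hadm 0).right⟩, ?_,
    fun j => (f j).2.2, strictMono_nat_of_lt_succ fun j => (href j).index_lt, rfl,
    fun j => (href j).near z (hz (j + 1)),
    fun j => (href j).far z (hz (j + 1))⟩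
  -- A covering interval containing `z` meets every nested interval, so its length is bounded by
  -- theirs, which tend to `0`.
  intro i hi
  have hlt : 0 < y i - x i := sub_pos.2 (hi.1.trans hi.2)
  obtain ⟨j, hj⟩ := exists_pow_lt_of_lt_one hlt (show (1 / 2 : ℝ) < 1 by norm_num)
  have h1 := (le_meetSum hus hu0 (x := x) (y := y) ⟨z, hi, hz j⟩).trans (hadm j).sum_le
  have h2 := hlen j
  have h3 : (f j).2.1 / 10 ^ 6 ≤ (f j).2.1 := div_le_self (hadm j).pos.le (by norm_num)
  linarith

/-! ### Resonance strength of the limit point -/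

theorem eventually_cofinite_lt_abs (B : ℤ) : ∀ᶠ k : ℤ in cofinite, B < |k| := by
  refine (Set.finite_Icc (-B) B).subset fun k hk => ?_
  have hk' : ¬ B < |k| := hk
  exact abs_le.1 (not_lt.1 hk')

theorem norm_coe_le (y : ℝ) (n : ℤ) : ‖(y : UnitAddCircle)‖ ≤ |y - n| := by
  rw [UnitAddCircle.norm_eq]
  exact round_le y n

theorem exists_norm_coe_eq (y : ℝ) : ∃ n : ℤ, ‖(y : UnitAddCircle)‖ = |y - n| :=
  ⟨round y, UnitAddCircle.norm_eq⟩

/-- A point is of resonance strength `δ` if it is approximated by a sequence of orbit points with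
rates tending to `δ`, and all its rates of approximation have upper limit at most `δ`. -/
theorem resonanceStrength_eq {α z : ℝ} {δ : EReal} {d β : ℕ → ℝ} {K : ℕ → ℤ} (hK : StrictMono K)
    (hK0 : K 0 = 0) (hz0 : ∀ n : ℤ, z ≠ n)
    (hd : Tendsto (fun j => (d j : EReal)) atTop (𝓝 δ))
    (hβ : Tendsto (fun j => (β j : EReal)) atTop (𝓝 δ))
    (hnear : ∀ j, ∃ n : ℤ, |z - K (j + 1) * α - n| ≤ Real.exp (-(d (j + 1) * K (j + 1))))
    (hfar : ∀ j, ∀ m : ℤ, K j < |m| → |m| ≤ K (j + 1) → ∀ e : ℤ,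
        Real.exp (-(β j * |(m : ℝ)|)) ≤ |z - m * α - e|) :
    resonanceStrength α z = δ := by
  have hKge : ∀ j : ℕ, (j : ℤ) ≤ K j := by
    intro j
    induction j with
    | zero => simp [hK0]
    | succ j ih => have := hK j.lt_add_one; push_cast; omega
  have hloc : ∀ m : ℤ, m ≠ 0 → ∃ j, K j < |m| ∧ |m| ≤ K (j + 1) := by
    intro m hm
    have hex : ∃ j, |m| ≤ K j := ⟨m.natAbs, by rw [Int.abs_eq_natAbs]; exact hKge _⟩
    have h0 : Nat.find hex ≠ 0 := by
      intro h
      have := Nat.find_spec hex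
      rw [h, hK0] at this
      exact hm (abs_nonpos_iff.1 this)
    obtain ⟨j, hj⟩ := Nat.exists_eq_succ_of_ne_zero h0
    refine ⟨j, not_le.1 (Nat.find_min hex (by omega)), ?_⟩
    have := Nat.find_spec hex
    rwa [hj] at this
  have horb : ¬ ∃ k n : ℤ, z = k * α + n := by
    rintro ⟨k, n, h⟩
    rcases eq_or_ne k 0 with rfl | hk
    -- The index `0` is never covered by `hfar`, hence the separate hypothesis that `z` is not an
    -- integer.
    · exact hz0 n (by simpa using h)
    · obtain ⟨j, h1, h2⟩ := hloc k hk
      have h3 := hfar j k h1 h2 n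
      rw [h, add_sub_cancel_left, sub_self, abs_zero] at h3
      exact absurd h3 (not_le.2 (Real.exp_pos _))
  rw [resonanceStrength, if_neg horb]
  apply le_antisymm
  · refine le_of_forall_gt_imp_ge_of_dense fun c hc => ?_
    obtain ⟨J, hJ⟩ := eventually_atTop.1 (hβ.eventually_lt_const hc)
    refine limsup_le_of_le (h := ?_)
    filter_upwards [eventually_cofinite_lt_abs (K J)] with m hm
    have hKJ : 0 ≤ K J := by have := hKge J; omega
    have hm0 : m ≠ 0 := by rintro rfl; rw [abs_zero] at hm; omega
    have hmR : 0 < |(m : ℝ)| := abs_pos.2 (by exact_mod_cast hm0)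
    obtain ⟨j, h1, h2⟩ := hloc m hm0
    have hJj : J ≤ j := by
      have : K J < K (j + 1) := hm.trans_le h2
      have := hK.lt_iff_lt.1 this
      omega
    refine le_trans ?_ (hJ j hJj).le
    obtain ⟨e, he⟩ := exists_norm_coe_eq (z - m * α)
    have h3 := hfar j m h1 h2 e
    rw [he, EReal.coe_le_coe_iff, div_le_iff₀ hmR]
    have h4 := Real.log_le_log (Real.exp_pos _) h3
    rw [Real.log_exp] at h4
    linarith
  · refine le_of_forall_lt_imp_le_of_dense fun c hc => ?_
    refine le_limsup_of_frequently_le ?_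
    have htend : Tendsto (fun j => K (j + 1)) atTop cofinite := by
      rw [← Nat.cofinite_eq_atTop]
      exact Function.Injective.tendsto_cofinite fun i j h => by
        have := hK.injective h
        omega
    refine htend.frequently (Eventually.frequently ?_)
    filter_upwards [(tendsto_add_atTop_nat 1).eventually (hd.eventually_const_lt hc)] with j hj
    refine hj.le.trans ?_
    have hKj : (0 : ℝ) < K (j + 1) := by
      have := hKge (j + 1)
      exact_mod_cast (by push_cast at this; omega : 0 < K (j + 1))
    obtain ⟨n, hn⟩ := hnear j
    obtain ⟨e, he⟩ := exists_norm_coe_eq (z - K (j + 1) * α)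
    have hpos : 0 < ‖((z - K (j + 1) * α : ℝ) : UnitAddCircle)‖ := by
      rw [he, abs_pos]
      intro h
      exact horb ⟨K (j + 1), e, by linarith⟩
    have h4 := Real.log_le_log hpos ((norm_coe_le _ n).trans hn)
    rw [Real.log_exp] at h4
    rw [EReal.coe_le_coe_iff, abs_of_pos hKj, le_div_iff₀ hKj]
    linarith

/-- The avoidance rate must strictly exceed the approximation rates at its own step and the next,
even when both tend to `δ`. The large `β 0` makes the initial interval admissible with starting
index `0`. -/
theorem exists_rates {δ : EReal} (hδ : 0 < δ) : ∃ d β : ℕ → ℝ, (∀ j, 0 < d j) ∧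
    (∀ j, d j < β j) ∧ (∀ j, d (j + 1) < β j) ∧ 10 ^ 7 ≤ β 0 ∧
    Tendsto (fun j => (d j : EReal)) atTop (𝓝 δ) ∧
    Tendsto (fun j => (β j : EReal)) atTop (𝓝 δ) := by
  induction δ with
  | bot => simp at hδ
  | coe r =>
    have hr : 0 < r := by exact_mod_cast hδ
    refine ⟨fun _ => r, fun j => r + 10 ^ 7 * (1 / ((j : ℝ) + 1)), fun _ => hr, fun j => ?_,
      fun j => ?_, ?_, tendsto_const_nhds, ?_⟩
    · exact lt_add_of_pos_right _ (by positivity)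
    · exact lt_add_of_pos_right _ (by positivity)
    · norm_num
      exact hr.le
    · rw [EReal.tendsto_coe]
      simpa using (tendsto_one_div_add_atTop_nhds_zero_nat (𝕜 := ℝ)).const_mul (10 ^ 7) |>.const_add r
  | top =>
    refine ⟨fun j => j + 1, fun j => j + 10 ^ 7, fun j => by positivity, fun j => by norm_num,
      fun j => ?_, by norm_num, ?_, ?_⟩
    · push_cast; linarith
    · rw [EReal.tendsto_coe_nhds_top_iff]
      exact tendsto_atTop_add_const_right _ _ tendsto_natCast_atTop_atTop
    · rw [EReal.tendsto_coe_nhds_top_iff]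
      exact tendsto_atTop_add_const_right _ _ tendsto_natCast_atTop_atTop

theorem exists_mem_resonanceSet_notMem_cover {α : ℝ} (hα : Irrational α) {δ : EReal} (hδ : 0 < δ)
    {x y : ℕ → ℝ} (hxy : ∀ i, x i ≤ y i) (hxy1 : ∀ i, y i - x i < 1)
    (hw : Summable fun i => logGauge 1 (y i - x i))
    (hsum : ∑' i, (y i - x i) ≤ 1 / 2 / 10 ^ 6) :
    ∃ z ∈ resonanceSet α δ, ∀ i, z ∉ Ioo (x i) (y i) := by
  obtain ⟨d, β, hd, hdβ, hdβ', hβ, hdt, hβt⟩ := exists_rates hδ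
  obtain ⟨z, hz, hzU, K, hK, hK0, hnear, hfar⟩ :=
    exists_notMem_cover hα hxy hxy1 hw hsum hd hdβ hdβ' hβ
  refine ⟨z, ⟨⟨by linarith [hz.1], by linarith [hz.2]⟩,
    resonanceStrength_eq hK hK0 ?_ hdt hβt hnear hfar⟩, hzU⟩
  rintro n rfl
  have h1 : (0 : ℝ) < n := by linarith [hz.1]
  have h2 : (n : ℝ) < 1 := by linarith [hz.2]
  have h1' : 0 < n := by exact_mod_cast h1
  have h2' : n < 1 := by exact_mod_cast h2
  omega

/-! ### Infinite measure for exponents at most one -/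

theorem logGauge_one_le {s r : ℝ} (hs : s ≤ 1) (hr : r ≤ Real.exp (-1)) :
    logGauge 1 r ≤ logGauge s r := by
  unfold logGauge
  split_ifs with h
  · apply Real.rpow_le_rpow_of_exponent_le _ (neg_le_neg hs)
    have := Real.log_le_log h.1 hr
    rw [Real.log_exp] at this
    linarith
  · exact le_rfl

theorem gaugeMeasure_resonanceSet_eq_top {α : ℝ} (hα : Irrational α) {δ : EReal} (hδ : 0 < δ)
    {s : ℝ} (hs : s ≤ 1) : gaugeMeasure (logGauge s) (resonanceSet α δ) = ⊤ := by
  refine ENNReal.eq_top_of_forall_nnreal_le fun T => ?_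
  set η : ℝ := 1 / (4 * 10 ^ 6 * (T + 1)) with hη
  have hη0 : 0 < η := by positivity
  -- Lengths below `exp (-1)` allow the passage from `s` to `1`; lengths below `η ^ 2` make the
  -- total length at most `2 * η * T`.
  set ε : ℝ := min (Real.exp (-1)) (η ^ 2) with hε
  have hε0 : 0 < ε := lt_min (Real.exp_pos _) (by positivity)
  have hε1 : ε < 1 := (min_le_left _ _).trans_lt (by rw [Real.exp_lt_one_iff]; norm_num)
  refine le_trans ?_ (le_iSup₂ (f := fun ε (_ : ε ∈ Ioo (0 : ℝ) 1) =>
    gaugePremeasure (logGauge s) ε (resonanceSet α δ)) ε ⟨hε0, hε1⟩)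
  refine le_sInf ?_
  rintro t ⟨x, y, hxy, hcov, rfl⟩
  by_contra! hlt
  have hle : ∑' i, ENNReal.ofReal (logGauge 1 (y i - x i)) < T :=
    (ENNReal.tsum_le_tsum fun i => ENNReal.ofReal_le_ofReal
      (logGauge_one_le hs ((hxy i).2.trans (min_le_left _ _)))).trans_lt hlt
  have hw : Summable fun i => logGauge 1 (y i - x i) :=
    (ENNReal.summable_toReal hle.ne_top).congr fun i =>
      ENNReal.toReal_ofReal (logGauge_nonneg _ _)
  have hwT : ∑' i, logGauge 1 (y i - x i) ≤ T := by
    rw [← ENNReal.ofReal_tsum_of_nonneg (fun i => logGauge_nonneg _ _) hw,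
      ← ENNReal.ofReal_coe_nnreal] at hle
    exact ((ENNReal.ofReal_lt_ofReal_iff_of_nonneg
      (tsum_nonneg fun i => logGauge_nonneg _ _)).1 hle).le
  have hxy1 : ∀ i, y i - x i < 1 := fun i => (hxy i).2.trans_lt hε1
  have hsum : ∑' i, (y i - x i) ≤ 1 / 2 / 10 ^ 6 := by
    calc ∑' i, (y i - x i) ≤ ∑' i, 2 * η * logGauge 1 (y i - x i) := by
          refine (summable_length (fun i => (hxy i).1) hxy1 hw).tsum_le_tsum (fun i => ?_)
            (hw.mul_left _)
          refine (le_two_mul_sqrt_mul_logGauge (sub_nonneg.2 (hxy i).1) (hxy1 i)).trans ?_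
          have := logGauge_nonneg 1 (y i - x i)
          have : √(y i - x i) ≤ η :=
            (Real.sqrt_le_left hη0.le).2 ((hxy i).2.trans (min_le_right _ _))
          gcongr
      _ = 2 * η * ∑' i, logGauge 1 (y i - x i) := tsum_mul_left
      _ ≤ 2 * η * (T + 1) := by gcongr; linarith
      _ = 1 / 2 / 10 ^ 6 := by rw [hη]; field_simp; norm_num
  obtain ⟨z, hz, hzU⟩ := exists_mem_resonanceSet_notMem_cover hα hδ (fun i => (hxy i).1) hxy1 hw hsum
  obtain ⟨i, hi⟩ := mem_iUnion.1 (hcov hz)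
  exact hzU i hi

/-! ### Zero measure for exponents above one -/

theorem gaugePremeasure_le_tsum {ι : Type*} [Countable ι] [Infinite ι] (ω : ℝ → ℝ) {ε : ℝ}
    {S : Set ℝ} {a b : ι → ℝ} (hab : ∀ i, a i ≤ b i ∧ b i - a i ≤ ε)
    (hS : S ⊆ ⋃ i, Ioo (a i) (b i)) :
    gaugePremeasure ω ε S ≤ ∑' i, ENNReal.ofReal (ω (b i - a i)) := by
  obtain ⟨e⟩ : Nonempty (ℕ ≃ ι) := nonempty_equiv_of_countable
  refine sInf_le ⟨a ∘ e, b ∘ e, fun i => hab (e i), ?_, ?_⟩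
  · rw [← e.surjective.iUnion_comp] at hS
    exact hS
  · exact (e.tsum_eq _).symm

theorem logGauge_exp_neg (s : ℝ) {t : ℝ} (ht : 0 < t) : logGauge s (Real.exp (-t)) = t ^ (-s) := by
  rw [logGauge, if_pos ⟨Real.exp_pos _, by rw [Real.exp_lt_one_iff]; linarith⟩, Real.log_exp,
    neg_neg]

/-- For `x` in `[0, 1]` only three integer translates of each orbit point matter, so the cover can
be indexed by `ℤ × Fin 3`. -/
theorem exists_fin_three_of_abs_le {α x : ℝ} (hx : x ∈ Icc (0 : ℝ) 1) {k n : ℤ}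
    (h : |x - k * α - n| ≤ 1 / 2) : ∃ o : Fin 3, (n : ℤ) = ⌊-(k * α)⌋ + (o : ℕ) := by
  have h1 := abs_le.1 h
  have h2 := Int.floor_le (-(k * α))
  have h3 := Int.lt_floor_add_one (-(k * α))
  have h4 : (⌊-(k * α)⌋ : ℝ) < n + 1 := by linarith [hx.1, hx.2]
  have h5 : (n : ℝ) < ⌊-(k * α)⌋ + 3 := by linarith [hx.1, hx.2]
  have h4' : ⌊-(k * α)⌋ < n + 1 := by exact_mod_cast h4
  have h5' : n < ⌊-(k * α)⌋ + 3 := by exact_mod_cast h5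
  exact ⟨⟨(n - ⌊-(k * α)⌋).toNat, by omega⟩, by simp only; omega⟩

/-- Points of positive resonance strength are covered by short intervals about the orbit points,
whose lengths decay exponentially in the index. -/
theorem exists_orbit_near_of_lt_resonanceStrength {α x c : ℝ} (hc : 0 < c)
    (hδ : ((3 * c : ℝ) : EReal) < resonanceStrength α x) (N : ℕ) :
    ∃ k n : ℤ, |x - k * α - n| < Real.exp (-(c * (|(k : ℝ)| + N))) / 2 := by
  by_cases horb : ∃ k n : ℤ, x = k * α + n
  · obtain ⟨k, n, h⟩ := horb
    refine ⟨k, n, ?_⟩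
    rw [h, add_sub_cancel_left, sub_self, abs_zero]
    positivity
  rw [resonanceStrength, if_neg horb] at hδ
  -- Of the rate `3 * c`, one `c * |k|` is kept, one exceeds `c * N`, and one exceeds `log 2`.
  have hev : ∀ᶠ k : ℤ in cofinite, max (N : ℤ) ⌈Real.log 2 / c⌉ < |k| :=
    eventually_cofinite_lt_abs _
  obtain ⟨k, hk, hkB⟩ := ((frequently_lt_of_lt_limsup (h := hδ)).and_eventually hev).exists
  have hkN : (N : ℝ) < |(k : ℝ)| := by exact_mod_cast (le_max_left _ _).trans_lt hkB
  have hk2 : Real.log 2 < c * |(k : ℝ)| := by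
    have h1 : ((⌈Real.log 2 / c⌉ : ℤ) : ℝ) < |(k : ℝ)| := by
      exact_mod_cast (le_max_right _ _).trans_lt hkB
    have h2 := (Int.le_ceil (Real.log 2 / c)).trans_lt h1
    rw [div_lt_iff₀ hc] at h2
    linarith
  have hk0 : 0 < |(k : ℝ)| := (Nat.cast_nonneg N).trans_lt hkN
  obtain ⟨n, hn⟩ := exists_norm_coe_eq (x - k * α)
  rw [EReal.coe_lt_coe_iff, lt_div_iff₀ hk0, hn] at hk
  refine ⟨k, n, ?_⟩
  have h3 : Real.exp (-(c * (|(k : ℝ)| + N))) / 2 =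
      Real.exp (-(c * (|(k : ℝ)| + N)) - Real.log 2) := by
    rw [Real.exp_sub, Real.exp_log two_pos]
  rw [h3]
  apply Real.lt_exp_of_log_lt
  nlinarith

theorem summable_rpow_neg_abs_add_one {s c : ℝ} (hs : 1 < s) (hc : 0 < c) :
    Summable fun k : ℤ => (c * (|(k : ℝ)| + 1)) ^ (-s) := by
  refine Summable.of_norm_bounded_eventually
    (g := fun k : ℤ => c ^ (-s) * |(k : ℝ)| ^ (-s)) ((Real.summable_abs_int_rpow hs).mul_left _) ?_
  filter_upwards [eventually_cofinite_lt_abs 0] with k hk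
  have hk0 : 0 < |(k : ℝ)| := by exact_mod_cast hk
  rw [Real.norm_of_nonneg (by positivity), ← Real.mul_rpow hc.le hk0.le]
  apply Real.rpow_le_rpow_of_nonpos (by positivity) _ (by linarith)
  gcongr
  linarith

theorem gaugeMeasure_resonanceSet_eq_zero {α : ℝ} {δ : EReal} (hδ : 0 < δ) {s : ℝ} (hs : 1 < s) :
    gaugeMeasure (logGauge s) (resonanceSet α δ) = 0 := by
  obtain ⟨r, hr0, hrδ⟩ := EReal.lt_iff_exists_real_btwn.1 hδ
  have hr : 0 < r := by exact_mod_cast hr0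
  set c := r / 3 with hcdef
  have hc : 0 < c := by positivity
  have h3c : ((3 * c : ℝ) : EReal) < δ := by
    have : 3 * c = r := by rw [hcdef]; ring
    rwa [this]
  refine le_antisymm (iSup₂_le fun ε hε => ?_) bot_le
  -- Shifting `|k|` by `N` keeps one index set for all covers: lengths fall below `ε`, and the total
  -- gauge tends to `0` by dominated convergence.
  set g : ℕ → ℤ × Fin 3 → ℝ := fun N z => (c * (|(z.1 : ℝ)| + N)) ^ (-s) with hg
  have hsum : Summable fun z : ℤ × Fin 3 => (c * (|(z.1 : ℝ)| + 1)) ^ (-s) := by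
    have := (summable_rpow_neg_abs_add_one hs hc).mul_of_nonneg
      (hasSum_fintype fun _ : Fin 3 => (1 : ℝ)).summable (fun k => by positivity)
      (fun _ => zero_le_one)
    simpa using this
  have hg0 : ∀ N z, 0 ≤ g N z := fun N z => by simp only [hg]; positivity
  have hgle : ∀ N : ℕ, 1 ≤ N → ∀ z, g N z ≤ (c * (|(z.1 : ℝ)| + 1)) ^ (-s) := by
    intro N hN z
    apply Real.rpow_le_rpow_of_nonpos (by positivity) _ (by linarith)
    have : (1 : ℝ) ≤ N := by exact_mod_cast hN
    gcongr
  have hlim : Tendsto (fun N => ∑' z, g N z) atTop (𝓝 0) := by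
    have h := tendsto_tsum_of_dominated_convergence (𝓕 := atTop) (f := g) (g := fun _ => (0 : ℝ))
      hsum (fun z => ?_) ?_
    · simpa using h
    · refine (tendsto_rpow_neg_atTop (by linarith)).comp ?_
      exact (tendsto_atTop_add_const_left _ _ tendsto_natCast_atTop_atTop).const_mul_atTop hc
    · filter_upwards [eventually_ge_atTop 1] with N hN z
      rw [Real.norm_of_nonneg (hg0 N z)]
      exact hgle N hN z
  have hlim' := ENNReal.tendsto_ofReal hlim
  rw [ENNReal.ofReal_zero] at hlim'
  refine ge_of_tendsto hlim' ?_
  have hexp : Tendsto (fun N : ℕ => Real.exp (-(c * N))) atTop (𝓝 0) :=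
    Real.tendsto_exp_neg_atTop_nhds_zero.comp
      (tendsto_natCast_atTop_atTop.const_mul_atTop hc)
  filter_upwards [eventually_ge_atTop 1, hexp.eventually_le_const hε.1] with N hN hNε
  have hNR : (1 : ℝ) ≤ N := by exact_mod_cast hN
  set p : ℤ × Fin 3 → ℝ := fun z => z.1 * α + (⌊-(z.1 * α)⌋ + (z.2 : ℕ) : ℤ) with hp
  set ρ : ℤ × Fin 3 → ℝ := fun z => Real.exp (-(c * (|(z.1 : ℝ)| + N))) with hρ
  have hρ0 : ∀ z, 0 < ρ z := fun z => Real.exp_pos _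
  have hlen : ∀ z, p z + ρ z / 2 - (p z - ρ z / 2) = ρ z := fun z => by ring
  have hcov := gaugePremeasure_le_tsum (logGauge s) (ε := ε) (S := resonanceSet α δ)
    (a := fun z => p z - ρ z / 2) (b := fun z => p z + ρ z / 2) (fun z => ?_) (fun x hx => ?_)
  · refine hcov.trans_eq ?_
    rw [ENNReal.ofReal_tsum_of_nonneg (hg0 N)
      (hsum.of_nonneg_of_le (hg0 N) (hgle N hN))]
    congr 1
    ext z
    rw [hlen, logGauge_exp_neg s (by positivity)]
  · rw [hlen]
    refine ⟨by linarith [hρ0 z], le_trans ?_ hNε⟩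
    apply Real.exp_le_exp.2
    nlinarith [abs_nonneg (z.1 : ℝ)]
  · obtain ⟨k, n, hkn⟩ := exists_orbit_near_of_lt_resonanceStrength hc (hx.2 ▸ h3c) N
    have hle : Real.exp (-(c * (|(k : ℝ)| + N))) ≤ 1 := by
      rw [Real.exp_le_one_iff]
      have : 0 ≤ c * (|(k : ℝ)| + N) := by positivity
      linarith
    obtain ⟨o, ho⟩ := exists_fin_three_of_abs_le hx.1 (by linarith : |x - k * α - n| ≤ 1 / 2)
    refine mem_iUnion.2 ⟨(k, o), ?_⟩
    have h1 := abs_lt.1 hkn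
    simp only [hp, hρ, ← ho]
    constructor <;> linarith [h1.1, h1.2]

end LogHausdorff

theorem theorem1p4 (α : ℝ) (hα : Irrational α) (δ : EReal) (hδ : 0 < δ) :
    (∀ s : ℝ,
      (1 < s → LogHausdorff.gaugeMeasure (LogHausdorff.logGauge s)
        (LogHausdorff.resonanceSet α δ) = 0) ∧
      (s ≤ 1 → LogHausdorff.gaugeMeasure (LogHausdorff.logGauge s)
        (LogHausdorff.resonanceSet α δ) = ⊤)) ∧
    LogHausdorff.dimHLog (LogHausdorff.resonanceSet α δ) = 1 := by
  have hzero : ∀ s : ℝ, 1 < s → LogHausdorff.gaugeMeasure (LogHausdorff.logGauge s)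
      (LogHausdorff.resonanceSet α δ) = 0 := fun s hs =>
    LogHausdorff.gaugeMeasure_resonanceSet_eq_zero hδ hs
  have htop : ∀ s : ℝ, s ≤ 1 → LogHausdorff.gaugeMeasure (LogHausdorff.logGauge s)
      (LogHausdorff.resonanceSet α δ) = ⊤ := fun s hs =>
    LogHausdorff.gaugeMeasure_resonanceSet_eq_top hα hδ hs
  refine ⟨fun s => ⟨hzero s, htop s⟩, le_antisymm ?_ ?_⟩
  · refine le_of_forall_gt_imp_ge_of_dense fun t ht => ?_
    rcases eq_or_ne t ⊤ with rfl | htt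
    · exact le_top
    have h1 : 1 < t.toReal := by
      rw [← ENNReal.toReal_one]
      exact (ENNReal.toReal_lt_toReal ENNReal.one_ne_top htt).2 ht
    refine (iInf_le_of_le t.toReal (iInf_le_of_le (zero_lt_one.trans h1) (iInf_le_of_le ?_ le_rfl))).trans
      (ENNReal.ofReal_toReal htt).le
    rw [hzero _ h1]
    exact ENNReal.zero_lt_top
  · refine le_iInf fun s => le_iInf fun _ => le_iInf fun hfin => ?_
    rw [← ENNReal.ofReal_one]
    apply ENNReal.ofReal_le_ofReal
    by_contra! hs
    rw [htop s hs.le] at hfin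
    exact lt_irrefl _ hfin
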